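/- \textbf{Theorem.} $\mathsf{RCA}_0 \vdash \mathsf{SEM} \rightarrow \mathsf{RWKL}$. Equivalently (by the completeness theorem), every model $(M,\mathcal S)$ of $\mathsf{RCA}_0$, with possibly nonstandard first-order part $M$, that satisfies $\mathsf{SEM}$ also satisfies $\mathsf{RWKL}$. Here $\mathsf{RCA}_0$ is the subsystem of second-order arithmetic (language $0,1,+,\cdot,<,\in$) whose axioms are the basic axioms $m+1\neq 0$; $m+1=n+1\rightarrow m=n$; $m+0=m$; $m+(n+1)=(m+n)+1$; $m\cdot 0=0$; $m\cdot(n+1)=m\cdot n+m$; $\neg(m<0)$; $m<n+1\leftrightarrow(m<n\vee m=n)$; together with the $\Sigma^0_1$ induction scheme and the $\Delta^0_1$ comprehension scheme (number and set parameters allowed). In the following, $\mathbb N$ denotes the first-order part, all sets are sets of the model, a set of numbers is infinite if it is unbounded, and pairs and finite strings are coded by numbers in a standard way. A \emph{tournament} $(D,R)$ consists of a set $D\subseteq\mathbb N$ and an irreflexive binary relation $R$ on $D$ such that for all $x\neq y$ in $D$ exactly one of $R(x,y)$, $R(y,x)$ holds. It is \emph{stable} if $(\forall x\in D)(\exists n)[(\forall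 y>n)(y\in D\rightarrow R(x,y))\vee(\forall y>n)(y\in D\rightarrow R(y,x))]$. A \emph{sub-tournament} is a tournament $(E,E^2\cap R)$ with $E\subseteq D$; it is \emph{transitive} if its relation is transitive. $\mathsf{SEM}$ (the stable Erd\H{o}s--Moser theorem) is the statement: every infinite stable tournament has an infinite transitive sub-tournament. A \emph{subtree} of $2^{<\mathbb N}$ is a set $T$ of finite binary strings that is closed under prefixes. A set $H\subseteq\mathbb N$ is \emph{homogeneous for} a string $\sigma\in 2^{<\mathbb N}$ if $(\exists c<2)(\forall i\in H)(i<|\sigma|\rightarrow\sigma(i)=c)$, and \emph{homogeneous for} an infinite tree $T\subseteq 2^{<\mathbb N}$ if $\{\sigma\in T: H\text{ is homogeneous for }\sigma\}$ is infinite. $\mathsf{RWKL}$ (Ramsey-type weak K\"onig's lemma) is the statement: for every infinite subtree of $2^{<\mathbb N}$ there is an infinite homogeneous set. -/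

import Mathlib

/-! Second-order arithmetic.  A structure for the two-sorted language `0, 1, +, ·, <, ∈` is a type
`M` (the first-order part, possibly nonstandard) with these operations, together with a collection
`S` of subsets of `M` (the second-order part). -/

namespace SecondOrderArith

universe u

/-! ### Syntax: numerical terms and bounded-quantifier formulas

Number variables and set variables are numbered by natural numbers.  Bound number variables are
de Bruijn indices: below a quantifier, variable `0` is the bound one and variable `i + 1` is the
variable `i` of the context outside. -/

/-- Numerical terms. -/
inductive Term : Type
  | var (i : ℕ) : Term
  | zero : Term
  | one : Term
  | add (s t : Term) : Term
  | mul (s t : Term) : Term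

/-- Bounded-quantifier formulas (`Σ⁰₀`), with free number variables and free set variables. -/
inductive BddFormula : Type
  | eq (s t : Term) : BddFormula
  | lt (s t : Term) : BddFormula
  | mem (t : Term) (X : ℕ) : BddFormula
  | not (φ : BddFormula) : BddFormula
  | and (φ ψ : BddFormula) : BddFormula
  | or (φ ψ : BddFormula) : BddFormula
  | imp (φ ψ : BddFormula) : BddFormula
  /-- `∀ x < t, φ`, where the term `t` is read outside of the quantifier -/
  | all (t : Term) (φ : BddFormula) : BddFormula
  /-- `∃ x < t, φ`, where the term `t` is read outside of the quantifier -/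
  | ex (t : Term) (φ : BddFormula) : BddFormula

/-- The assignment that sends variable `0` to `x` and variable `i + 1` to `v i`. -/
def push {M : Type u} (x : M) (v : ℕ → M) : ℕ → M
  | 0 => x
  | i + 1 => v i

section Semantics

variable {M : Type u} [Zero M] [One M] [Add M] [Mul M] [LT M]

/-- The value of a term under an assignment. -/
def Term.val (v : ℕ → M) : Term → M
  | .var i => v i
  | .zero => 0
  | .one => 1
  | .add s t => s.val v + t.val v
  | .mul s t => s.val v * t.val v

/-- Satisfaction of a bounded-quantifier formula under assignments `v` of the number variables
and `w` of the set variables. -/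
def BddFormula.Sat (w : ℕ → Set M) : BddFormula → (ℕ → M) → Prop
  | .eq s t, v => s.val v = t.val v
  | .lt s t, v => s.val v < t.val v
  | .mem t X, v => t.val v ∈ w X
  | .not φ, v => ¬ φ.Sat w v
  | .and φ ψ, v => φ.Sat w v ∧ ψ.Sat w v
  | .or φ ψ, v => φ.Sat w v ∨ ψ.Sat w v
  | .imp φ ψ, v => φ.Sat w v → ψ.Sat w v
  | .all t φ, v => ∀ x : M, x < t.val v → φ.Sat w (push x v)
  | .ex t φ, v => ∃ x : M, x < t.val v ∧ φ.Sat w (push x v)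

/-- Satisfaction of the `Σ⁰₁` formula `∃ y, θ`. -/
def SatSigma1 (θ : BddFormula) (w : ℕ → Set M) (v : ℕ → M) : Prop :=
  ∃ y : M, θ.Sat w (push y v)

/-- Satisfaction of the `Π⁰₁` formula `∀ y, θ`. -/
def SatPi1 (θ : BddFormula) (w : ℕ → Set M) (v : ℕ → M) : Prop :=
  ∀ y : M, θ.Sat w (push y v)

end Semantics

/-! ### The axioms of `RCA₀` -/

/-- The basic axioms of second-order arithmetic. -/
structure BasicAxioms (M : Type u) [Zero M] [One M] [Add M] [Mul M] [LT M] : Prop where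
  succ_ne_zero : ∀ m : M, m + 1 ≠ 0
  succ_inj : ∀ m n : M, m + 1 = n + 1 → m = n
  add_zero : ∀ m : M, m + 0 = m
  add_succ : ∀ m n : M, m + (n + 1) = (m + n) + 1
  mul_zero : ∀ m : M, m * 0 = 0
  mul_succ : ∀ m n : M, m * (n + 1) = (m * n) + m
  lt_succ : ∀ m n : M, m < n + 1 ↔ (m < n ∨ m = n)
  not_lt_zero : ∀ m : M, ¬ m < 0

section Systems

variable {M : Type u} [Zero M] [One M] [Add M] [Mul M] [LT M]

/-- `(M, S)` satisfies the `Σ⁰₁` induction scheme, with arbitrary number and set parameters. -/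
def Sigma1Induction (S : Set (Set M)) : Prop :=
  ∀ (θ : BddFormula) (w : ℕ → Set M) (v : ℕ → M), (∀ i, w i ∈ S) →
    SatSigma1 θ w (push 0 v) →
    (∀ n : M, SatSigma1 θ w (push n v) → SatSigma1 θ w (push (n + 1) v)) →
    ∀ n : M, SatSigma1 θ w (push n v)

/-- `(M, S)` satisfies the `Δ⁰₁` comprehension scheme, with arbitrary number and set parameters. -/
def Delta1Comprehension (S : Set (Set M)) : Prop :=
  ∀ (θ η : BddFormula) (w : ℕ → Set M) (v : ℕ → M), (∀ i, w i ∈ S) →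
    (∀ n : M, SatSigma1 θ w (push n v) ↔ SatPi1 η w (push n v)) →
    ∃ X ∈ S, ∀ n : M, n ∈ X ↔ SatSigma1 θ w (push n v)

/-- `(M, S)` is a model of `RCA₀`.  As usual, both sorts of a structure are nonempty. -/
structure ModelsRCA0 (S : Set (Set M)) : Prop where
  sets_nonempty : S.Nonempty
  basic : BasicAxioms M
  induction : Sigma1Induction S
  comprehension : Delta1Comprehension S

/-! ### Notions interpreted inside a structure -/

/-- A set of numbers is infinite (in the sense of the structure) if it is unbounded. -/
def Infinite (X : Set M) : Prop :=
  ∀ k : M, ∃ n ∈ X, k < n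

/-- The pairing function `(x + y)² + x`. -/
def pair (x y : M) : M :=
  (x + y) * (x + y) + x

/-- The binary relation coded by a set of pairs. -/
def Rel (R : Set M) (x y : M) : Prop :=
  pair x y ∈ R

/-! ### The stable Erdős–Moser principle -/

/-- `(D, R)` is a tournament: `R` is (a set of pairs coding) an irreflexive relation on `D` such
that for distinct `x, y ∈ D` exactly one of `R(x, y)` and `R(y, x)` holds. -/
structure IsTournament (D R : Set M) : Prop where
  on : ∀ z ∈ R, ∃ x ∈ D, ∃ y ∈ D, z = pair x y
  irrefl : ∀ x ∈ D, ¬ Rel R x x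
  exactly_one : ∀ x ∈ D, ∀ y ∈ D, x ≠ y → Xor (Rel R x y) (Rel R y x)

/-- A tournament `(D, R)` is stable. -/
def IsStable (D R : Set M) : Prop :=
  ∀ x ∈ D, ∃ n : M,
    (∀ y : M, n < y → y ∈ D → Rel R x y) ∨ (∀ y : M, n < y → y ∈ D → Rel R y x)

/-- `(E, U)` is the sub-tournament `(E, E² ∩ R)` of `(D, R)`, where `E ⊆ D`. -/
def IsSubTournament (E U D R : Set M) : Prop :=
  E ⊆ D ∧ ∀ z : M, z ∈ U ↔ (z ∈ R ∧ ∃ x ∈ E, ∃ y ∈ E, z = pair x y)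

/-- The relation coded by `U` is transitive. -/
def IsTransitive (U : Set M) : Prop :=
  ∀ x y z : M, Rel U x y → Rel U y z → Rel U x z

/-- `(M, S)` satisfies `SEM`: every infinite stable tournament has an infinite transitive
sub-tournament. -/
def SEM (S : Set (Set M)) : Prop :=
  ∀ D ∈ S, ∀ R ∈ S, IsTournament D R → Infinite D → IsStable D R →
    ∃ E ∈ S, ∃ U ∈ S, IsSubTournament E U D R ∧ Infinite E ∧ IsTransitive U

/-! ### Finite binary strings, trees, and Ramsey-type weak König's lemma

Finite sets are coded in the usual way by divisibility: a triple `(l, m, n)` stands for the binary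
string of length `l` whose `i`-th entry is `1` exactly if `m * (i + 1) + 1` divides `n`.  A string
is represented by its least code. -/

/-- `m * (i + 1) + 1` divides `n`. -/
def Bit (m n i : M) : Prop :=
  ∃ q : M, n = (m * (i + 1) + 1) * q

/-- The number that codes the triple `(l, m, n)`. -/
def triple (l m n : M) : M :=
  pair (pair l m) n

/-- `σ` is (the code of) a finite binary string, `σ ∈ 2^{<ℕ}`: it codes a triple, and no smaller
number codes a triple for the same string. -/
def IsString (σ : M) : Prop :=
  ∃ l m n : M, σ = triple l m n ∧
    ∀ m' n' : M, (∀ i : M, i < l → (Bit m' n' i ↔ Bit m n i)) → ¬ triple l m' n' < σ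

/-- `|σ| = l`. -/
def HasLength (σ l : M) : Prop :=
  ∃ m n : M, σ = triple l m n

/-- `i < |σ|` and `σ(i) = c`. -/
def HasValue (σ i c : M) : Prop :=
  ∃ l m n : M, σ = triple l m n ∧ i < l ∧ ((Bit m n i ∧ c = 1) ∨ (¬ Bit m n i ∧ c = 0))

/-- `τ ⪯ σ`: the domain of `τ` is contained in the domain of `σ`, and `σ` agrees with `τ` there. -/
def IsPrefix (τ σ : M) : Prop :=
  ∀ i c : M, HasValue τ i c → HasValue σ i c

/-- `T` is a subtree of `2^{<ℕ}`. -/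
structure IsBinaryTree (T : Set M) : Prop where
  strings : ∀ σ ∈ T, IsString σ
  closed : ∀ σ ∈ T, ∀ τ : M, IsString τ → IsPrefix τ σ → τ ∈ T

/-- The set `H` is homogeneous for the string `σ`. -/
def HomogeneousForString (H : Set M) (σ : M) : Prop :=
  ∃ c : M, (c = 0 ∨ c = 1) ∧
    ∀ i ∈ H, ∀ l : M, HasLength σ l → i < l → HasValue σ i c

/-- The set `H` is homogeneous for the tree `T`. -/
def HomogeneousForTree (H T : Set M) : Prop :=
  Infinite {σ : M | σ ∈ T ∧ HomogeneousForString H σ}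

/-- `(M, S)` satisfies `RWKL`: for every infinite subtree of `2^{<ℕ}` there is an infinite
homogeneous set. -/
def RWKL (S : Set (Set M)) : Prop :=
  ∀ T ∈ S, IsBinaryTree T → Infinite T →
    ∃ H ∈ S, Infinite H ∧ HomogeneousForTree H T

end Systems

end SecondOrderArith

/-! Let `T` be an infinite tree and let `σ_s` be the lexicographically least string of `T` of length
`s`. For `x < s` put `R(x, s)` if `σ_s(x) = 1` and `R(s, x)` otherwise. This is a tournament on all
numbers. It is stable because the leftmost strings converge: by strong `Σ⁰₁` collection there is one
level below which every string of length `k` that is not extendible to all levels has already died,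
and beyond it all `σ_s` agree below `k` (`leftmost_stable`).

Let `E` be an infinite transitive sub-tournament given by `SEM`. If `s ∈ E`, then the ones of `σ_s`
in `E` are the `R`-predecessors of `s` below `s`, and transitivity makes them closed downwards under
`R` among the positions of `σ_s`. So the subtree `C` of those strings of `T` that are cuts of `E` in
this sense is infinite (`infinite_cutTree`).

Suppose that some `x ∈ E` takes both values at every level of `C` above `x`. Cuts with `1` at `x`
have `1` at every predecessor of `x`, cuts with `0` at `x` have `0` at every successor; both sets
are homogeneous for `T`, and one of them is infinite. Otherwise each `x ∈ E` has a value that is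
forced at some level of `C`. Exactly one value is forced, so the two `Σ⁰₁` classes are complementary
in `E`, hence are sets; one is infinite, and it is homogeneous (`exists_homogeneous_of_cutTree`).

Everything must be carried out in `RCA₀`. Definability is tracked by the classes `TermFn`, `Sigma1`
and `Delta1`, so that instance search discharges it, and finite sets are coded by divisibility by
pairwise coprime moduli (`IsModulus.exists_code`). -/

namespace SecondOrderArith

set_option linter.unusedSectionVars false

universe u

/-! ### Substitution -/

/-- Simultaneous substitution of terms for the number variables of a term. -/
def Term.subst (f : ℕ → Term) : Term → Term
  | .var i => f i
  | .zero => .zero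
  | .one => .one
  | .add s t => .add (s.subst f) (t.subst f)
  | .mul s t => .mul (s.subst f) (t.subst f)

/-- The substitution `f` below a quantifier. -/
def liftSubst (f : ℕ → Term) : ℕ → Term
  | 0 => .var 0
  | i + 1 => (f i).subst fun j => .var (j + 1)

/-- Substitution of terms for number variables, and renaming of set variables. -/
def BddFormula.subst (g : ℕ → ℕ) : (ℕ → Term) → BddFormula → BddFormula
  | f, .eq s t => .eq (s.subst f) (t.subst f)
  | f, .lt s t => .lt (s.subst f) (t.subst f)
  | f, .mem t X => .mem (t.subst f) (g X)
  | f, .not φ => .not (φ.subst g f)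
  | f, .and φ ψ => .and (φ.subst g f) (ψ.subst g f)
  | f, .or φ ψ => .or (φ.subst g f) (ψ.subst g f)
  | f, .imp φ ψ => .imp (φ.subst g f) (ψ.subst g f)
  | f, .all t φ => .all (t.subst f) (φ.subst g (liftSubst f))
  | f, .ex t φ => .ex (t.subst f) (φ.subst g (liftSubst f))

/-- The assignment that is `v` on even and `p` on odd variables. -/
def mix {α : Type*} (v p : ℕ → α) (i : ℕ) : α :=
  if i % 2 = 0 then v (i / 2) else p (i / 2)

@[simp] lemma mix_even {α : Type*} (v p : ℕ → α) (i : ℕ) : mix v p (2 * i) = v i := by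
  simp [mix]

@[simp] lemma mix_odd {α : Type*} (v p : ℕ → α) (i : ℕ) : mix v p (2 * i + 1) = p i := by
  have : (2 * i + 1) / 2 = i := by omega
  simp [mix, this]

lemma forall_mix {α : Type*} {v p : ℕ → α} {Q : α → Prop} (hv : ∀ i, Q (v i))
    (hp : ∀ i, Q (p i)) (i : ℕ) : Q (mix v p i) := by
  unfold mix; split_ifs <;> simp [hv, hp]

lemma even_odd_ext {α : Type*} {f g : ℕ → α} (h0 : ∀ i, f (2 * i) = g (2 * i))
    (h1 : ∀ i, f (2 * i + 1) = g (2 * i + 1)) : f = g := by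
  funext i
  rcases Nat.even_or_odd' i with ⟨k, rfl | rfl⟩
  exacts [h0 k, h1 k]

section

variable {M : Type u} [Zero M] [One M] [Add M] [Mul M]

lemma Term.val_subst (f : ℕ → Term) (v : ℕ → M) (t : Term) :
    (t.subst f).val v = t.val fun i => (f i).val v := by
  induction t <;> simp_all [Term.subst, Term.val]

lemma val_liftSubst (f : ℕ → Term) (v : ℕ → M) (x : M) :
    (fun i => (liftSubst f i).val (push x v)) = push x fun i => (f i).val v := by
  funext i
  cases i with
  | zero => rfl
  | succ i => simp [liftSubst, Term.val_subst, push, Term.val]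

/-! ### Definable functions and relations

Contexts are assignments `v : ℕ → M`; parameters from `M` and from `S` are allowed. -/

/-- `t` is given by a term with parameters. -/
class TermFn (t : (ℕ → M) → M) : Prop where
  out : ∃ (τ : Term) (p : ℕ → M), ∀ v, t v = τ.val (mix v p)

/-- Moves the parameters into the even parameters. -/
def toEven (i : ℕ) : Term := .var (if i % 2 = 0 then i else 2 * (2 * (i / 2)) + 1)

/-- Moves the parameters into the odd parameters. -/
def toOdd (i : ℕ) : Term := .var (if i % 2 = 0 then i else 2 * (2 * (i / 2) + 1) + 1)

lemma val_toEven (v p q : ℕ → M) : (fun i => (toEven i).val (mix v (mix p q))) = mix v p := by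
  apply even_odd_ext <;> intro i
  · simp [toEven, Term.val]
  · have : (2 * i + 1) / 2 = i := by omega
    simp [toEven, Term.val, this]

lemma val_toOdd (v p q : ℕ → M) : (fun i => (toOdd i).val (mix v (mix p q))) = mix v q := by
  apply even_odd_ext <;> intro i
  · simp [toOdd, Term.val]
  · have : (2 * i + 1) / 2 = i := by omega
    simp [toOdd, Term.val, this]

/-- In a code, even variables read the context and odd variables the parameters. Interleaving the
two parameter assignments lets both codes share one. -/
lemma TermFn.pair {s t : (ℕ → M) → M} (hs : TermFn s) (ht : TermFn t) :
    ∃ (σ τ : Term) (p : ℕ → M), (∀ v, s v = σ.val (mix v p)) ∧ ∀ v, t v = τ.val (mix v p) := by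
  obtain ⟨σ, p, hσ⟩ := hs.out
  obtain ⟨τ, q, hτ⟩ := ht.out
  refine ⟨σ.subst toEven, τ.subst toOdd, mix p q, fun v => ?_, fun v => ?_⟩
  · rw [Term.val_subst, val_toEven, hσ]
  · rw [Term.val_subst, val_toOdd, hτ]

instance TermFn.var (i : ℕ) : TermFn (fun v : ℕ → M => v i) :=
  ⟨.var (2 * i), fun _ => 0, by simp [Term.val]⟩

instance TermFn.const (c : M) : TermFn (fun _ : ℕ → M => c) :=
  ⟨.var (2 * 0 + 1), fun _ => c, fun v => by simp only [Term.val, mix_odd]⟩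

instance TermFn.add {s t : (ℕ → M) → M} [hs : TermFn s] [ht : TermFn t] :
    TermFn (fun v => s v + t v) := by
  obtain ⟨σ, τ, p, h1, h2⟩ := hs.pair ht
  exact ⟨.add σ τ, p, fun v => by simp [Term.val, h1, h2]⟩

instance TermFn.mul {s t : (ℕ → M) → M} [hs : TermFn s] [ht : TermFn t] :
    TermFn (fun v => s v * t v) := by
  obtain ⟨σ, τ, p, h1, h2⟩ := hs.pair ht
  exact ⟨.mul σ τ, p, fun v => by simp [Term.val, h1, h2]⟩

/-- `T` is a transformation of assignments given by terms. -/
def IsSubst (T : (ℕ → M) → ℕ → M) : Prop :=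
  ∃ (f : ℕ → Term) (p : ℕ → M), ∀ v i, T v i = (f i).val (mix v p)

lemma IsSubst.reindex (f : ℕ → ℕ) : IsSubst (fun (v : ℕ → M) i => v (f i)) :=
  ⟨fun i => .var (2 * f i), fun _ => 0, by simp [Term.val]⟩

lemma IsSubst.id : IsSubst (fun v : ℕ → M => v) := IsSubst.reindex fun i => i

lemma IsSubst.push {T : (ℕ → M) → ℕ → M} (hT : IsSubst T) (t : (ℕ → M) → M) [ht : TermFn t] :
    IsSubst (fun v => push (t v) (T v)) := by
  obtain ⟨f, p, hf⟩ := hT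
  obtain ⟨τ, q, hτ⟩ := ht.out
  refine ⟨fun i => Nat.casesOn i (τ.subst toEven) fun j => (f j).subst toOdd, mix q p, ?_⟩
  rintro v (_ | i)
  · exact ((Term.val_subst _ _ τ).trans (by rw [val_toEven]; exact (hτ v).symm)).symm
  · exact ((Term.val_subst _ _ (f i)).trans (by rw [val_toOdd, ← hf]; rfl)).symm

/-- A code for the substitution that turns `mix v (mix q p)` into `mix (T v) q`, where `T` is given
by `f` with parameters `p`. -/
def compSubst (f : ℕ → Term) (i : ℕ) : Term :=
  if i % 2 = 0 then (f (i / 2)).subst toOdd else toEven i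

lemma val_compSubst {f : ℕ → Term} {T : (ℕ → M) → ℕ → M} {p : ℕ → M}
    (hf : ∀ v i, T v i = (f i).val (mix v p)) (v q : ℕ → M) :
    (fun i => (compSubst f i).val (mix v (mix q p))) = mix (T v) q := by
  apply even_odd_ext <;> intro i
  · simp only [compSubst, mix_even, hf, Nat.mul_mod_right, if_true, Term.val_subst, val_toOdd]
    simp
  · have := congrFun (val_toEven v q p) (2 * i + 1)
    simp only [mix_odd] at this
    have h2 : (2 * i + 1) % 2 ≠ 0 := by omega
    simp only [compSubst, mix_odd, if_neg h2, this]

lemma TermFn.comp {t : (ℕ → M) → M} {T : (ℕ → M) → ℕ → M} (ht : TermFn t) (hT : IsSubst T) :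
    TermFn (fun v => t (T v)) := by
  obtain ⟨f, p, hf⟩ := hT
  obtain ⟨τ, q, hτ⟩ := ht.out
  exact ⟨τ.subst (compSubst f), mix q p, fun v => by rw [hτ, Term.val_subst, val_compSubst hf]⟩

lemma IsSubst.comp {T U : (ℕ → M) → ℕ → M} (hT : IsSubst T) (hU : IsSubst U) :
    IsSubst (fun v => T (U v)) := by
  obtain ⟨f, p, hf⟩ := hU
  obtain ⟨g, q, hg⟩ := hT
  exact ⟨fun j => (g j).subst (compSubst f), mix q p,
    fun v j => by simp only [hg, Term.val_subst, val_compSubst hf]⟩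

/-- The transformation `T` below a quantifier. -/
lemma IsSubst.lift {T : (ℕ → M) → ℕ → M} (hT : IsSubst T) :
    IsSubst (fun v => SecondOrderArith.push (v 0) (T fun i => v (i + 1))) :=
  (hT.comp (IsSubst.reindex fun i => i + 1)).push fun v => v 0

/-- A code for the substitution that turns `push y (push n p)` into `mix (push y fun _ => n) p`. -/
def flattenSubst (i : ℕ) : Term :=
  if i = 0 then .var 0 else if i % 2 = 0 then .var 1 else .var (i / 2 + 2)

lemma val_flattenSubst (y n : M) (p : ℕ → M) :
    (fun i => (flattenSubst i).val (push y (push n p))) = mix (push y fun _ => n) p := by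
  apply even_odd_ext <;> intro i
  · rcases i with _ | i
    · simp [flattenSubst, push, Term.val, mix]
    · have h2 : 2 * (i + 1) ≠ 0 := by omega
      simp only [flattenSubst, mix_even, if_neg h2, Nat.mul_mod_right, if_true, Term.val, push]
  · have h1 : (2 * i + 1) % 2 ≠ 0 := by omega
    have h2 : (2 * i + 1) / 2 = i := by omega
    have h3 : 2 * i + 1 ≠ 0 := by omega
    simp only [flattenSubst, mix_odd, if_neg h1, if_neg h3, h2, Term.val, push]

/-! ### Bounded-quantifier relations with parameters -/

section Delta0

variable [LT M]

lemma BddFormula.sat_subst (g : ℕ → ℕ) (w : ℕ → Set M) (φ : BddFormula) :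
    ∀ (f : ℕ → Term) (v : ℕ → M), (φ.subst g f).Sat w v ↔
      φ.Sat (fun i => w (g i)) fun i => (f i).val v := by
  induction φ <;> intro f v <;> simp_all [BddFormula.subst, BddFormula.Sat, Term.val_subst,
    val_liftSubst]

/-- `P` is given by a bounded-quantifier formula with parameters. -/
def IsDelta0 (S : Set (Set M)) (P : (ℕ → M) → Prop) : Prop :=
  ∃ (θ : BddFormula) (w : ℕ → Set M) (p : ℕ → M), (∀ i, w i ∈ S) ∧ ∀ v, P v ↔ θ.Sat w (mix v p)

variable {S : Set (Set M)} {P Q : (ℕ → M) → Prop}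

lemma IsDelta0.comp {T : (ℕ → M) → ℕ → M} (hP : IsDelta0 S P) (hT : IsSubst T) :
    IsDelta0 S (fun v => P (T v)) := by
  obtain ⟨f, p, hf⟩ := hT
  obtain ⟨θ, w, q, hw, hθ⟩ := hP
  exact ⟨θ.subst (fun i => i) (compSubst f), w, mix q p, hw,
    fun v => by simp only [hθ, BddFormula.sat_subst, val_compSubst hf]⟩

lemma IsDelta0.pair (hP : IsDelta0 S P) (hQ : IsDelta0 S Q) :
    ∃ (θ η : BddFormula) (w : ℕ → Set M) (p : ℕ → M), (∀ i, w i ∈ S) ∧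
      (∀ v, P v ↔ θ.Sat w (mix v p)) ∧ ∀ v, Q v ↔ η.Sat w (mix v p) := by
  obtain ⟨θ, w, p, hw, hθ⟩ := hP
  obtain ⟨η, w', q, hw', hη⟩ := hQ
  refine ⟨θ.subst (fun i => 2 * i) toEven, η.subst (fun i => 2 * i + 1) toOdd, mix w w', mix p q,
    forall_mix hw hw', fun v => ?_, fun v => ?_⟩
  · rw [BddFormula.sat_subst, val_toEven, hθ]; simp
  · rw [BddFormula.sat_subst, val_toOdd, hη]; simp

lemma IsDelta0.not (hP : IsDelta0 S P) : IsDelta0 S (fun v => ¬ P v) := by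
  obtain ⟨θ, w, p, hw, hθ⟩ := hP
  exact ⟨.not θ, w, p, hw, fun v => by simp [BddFormula.Sat, hθ]⟩

lemma IsDelta0.and (hP : IsDelta0 S P) (hQ : IsDelta0 S Q) : IsDelta0 S (fun v => P v ∧ Q v) := by
  obtain ⟨θ, η, w, p, hw, hθ, hη⟩ := hP.pair hQ
  exact ⟨.and θ η, w, p, hw, fun v => by simp [BddFormula.Sat, hθ, hη]⟩

lemma IsDelta0.or (hP : IsDelta0 S P) (hQ : IsDelta0 S Q) : IsDelta0 S (fun v => P v ∨ Q v) := by
  obtain ⟨θ, η, w, p, hw, hθ, hη⟩ := hP.pair hQ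
  exact ⟨.or θ η, w, p, hw, fun v => by simp [BddFormula.Sat, hθ, hη]⟩

lemma IsDelta0.eq (hS : S.Nonempty) {s t : (ℕ → M) → M} (hs : TermFn s) (ht : TermFn t) :
    IsDelta0 S (fun v => s v = t v) := by
  obtain ⟨σ, τ, p, h1, h2⟩ := hs.pair ht
  exact ⟨.eq σ τ, fun _ => hS.some, p, fun _ => hS.some_mem,
    fun v => by simp [BddFormula.Sat, h1, h2]⟩

lemma IsDelta0.lt (hS : S.Nonempty) {s t : (ℕ → M) → M} (hs : TermFn s) (ht : TermFn t) :
    IsDelta0 S (fun v => s v < t v) := by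
  obtain ⟨σ, τ, p, h1, h2⟩ := hs.pair ht
  exact ⟨.lt σ τ, fun _ => hS.some, p, fun _ => hS.some_mem,
    fun v => by simp [BddFormula.Sat, h1, h2]⟩

lemma IsDelta0.mem {X : Set M} (hX : X ∈ S) {t : (ℕ → M) → M} (ht : TermFn t) :
    IsDelta0 S (fun v => t v ∈ X) := by
  obtain ⟨τ, p, h⟩ := ht.out
  exact ⟨.mem τ 0, fun _ => X, p, fun _ => hX, fun v => by simp [BddFormula.Sat, h]⟩

lemma IsDelta0.bex (hP : IsDelta0 S P) {t : (ℕ → M) → M} (ht : TermFn t) :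
    IsDelta0 S (fun v => ∃ x, x < t v ∧ P (push x v)) := by
  obtain ⟨τ, q, hτ⟩ := ht.out
  obtain ⟨θ, w, p, hw, hθ⟩ := hP
  -- The body is evaluated at `push x (mix v (mix q p))`: the bound variable is `0`, the quantifier
  -- shifts every other index up by one, and the parameters `p` of `θ` sit at the odd places of `mix
  -- q p`.
  refine ⟨.ex (τ.subst toEven) (θ.subst (fun i => i) fun i => if i = 0 then .var 0 else
    if i % 2 = 0 then .var (i - 1) else .var (2 * (2 * (i / 2) + 1) + 2)), w, mix q p, hw, ?_⟩
  intro v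
  simp only [BddFormula.Sat, Term.val_subst, val_toEven, ← hτ, BddFormula.sat_subst, hθ]
  refine exists_congr fun x => and_congr_right fun _ => ?_
  congr! 1
  apply even_odd_ext <;> intro i
  · rcases i with _ | i
    · simp [push, Term.val, mix]
    · have h1 : 2 * (i + 1) - 1 = 2 * i + 1 := by omega
      have h2 : 2 * (i + 1) ≠ 0 := by omega
      simp only [mix_even, if_neg h2, Nat.mul_mod_right, if_true, Term.val, h1, push]
  · have h1 : (2 * i + 1) % 2 ≠ 0 := by omega
    have h2 : (2 * i + 1) / 2 = i := by omega
    have h3 : 2 * i + 1 ≠ 0 := by omega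
    simp only [mix_odd, if_neg h1, if_neg h3, h2, Term.val, push]

lemma IsDelta0.ball (hP : IsDelta0 S P) {t : (ℕ → M) → M} (ht : TermFn t) :
    IsDelta0 S (fun v => ∀ x, x < t v → P (push x v)) := by
  have := (hP.not.bex ht).not
  simpa using this

end Delta0

variable [LT M]

/-! ### `Σ⁰₁` relations -/

/-- `P` is given by a `Σ⁰₁` formula with parameters. -/
class Sigma1 (S : Set (Set M)) (P : (ℕ → M) → Prop) : Prop where
  out : ∃ Q, IsDelta0 S Q ∧ ∀ v, P v ↔ ∃ y, Q (push y v)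

section Sigma1

variable {S : Set (Set M)}

lemma IsDelta0.sigma1 {P : (ℕ → M) → Prop} (hP : IsDelta0 S P) : Sigma1 S P :=
  ⟨fun v => P fun i => v (i + 1), hP.comp (IsSubst.reindex _), fun _ => ⟨fun h => ⟨0, h⟩,
    fun ⟨_, h⟩ => h⟩⟩

lemma Sigma1.comp {P : (ℕ → M) → Prop} (hP : Sigma1 S P) {T : (ℕ → M) → ℕ → M} (hT : IsSubst T) :
    Sigma1 S (fun v => P (T v)) := by
  obtain ⟨Q, hQ, h⟩ := hP.out
  exact ⟨_, hQ.comp hT.lift, fun v => h (T v)⟩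

/-- The scheme lists witness, argument and parameters in a row, whereas `IsDelta0` interleaves;
`flattenSubst` translates. Only variable `0` of the context matters, so the context may be
constantly `n`. -/
lemma Sigma1Induction.induct (hS : Sigma1Induction S) {P : M → Prop}
    (hP : Sigma1 S (fun v => P (v 0))) (h0 : P 0) (h1 : ∀ n, P n → P (n + 1)) (n : M) : P n := by
  obtain ⟨Q, ⟨θ, w, p, hw, hθ⟩, h⟩ := hP.out
  have key : ∀ n, SatSigma1 (θ.subst (fun i => i) flattenSubst) w (push n p) ↔ P n := by
    intro n
    simp only [SatSigma1, BddFormula.sat_subst, val_flattenSubst, ← hθ]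
    exact (h _).symm
  have := hS (θ.subst (fun i => i) flattenSubst) w p hw
  simp only [key] at this
  exact this h0 h1 n

lemma Delta1Comprehension.exists_set (hS : Delta1Comprehension S) {P : M → Prop}
    (hP : Sigma1 S (fun v => P (v 0))) (hP' : Sigma1 S (fun v => ¬ P (v 0))) : {n | P n} ∈ S := by
  obtain ⟨Q, hQ, h⟩ := hP.out
  obtain ⟨Q', hQ', h'⟩ := hP'.out
  obtain ⟨θ, η, w, p, hw, hθ, hη⟩ := hQ.pair hQ'
  have key : ∀ n, SatSigma1 (θ.subst (fun i => i) flattenSubst) w (push n p) ↔ P n := by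
    intro n
    simp only [SatSigma1, BddFormula.sat_subst, val_flattenSubst, ← hθ]
    exact (h _).symm
  -- The `Π⁰₁` definition of `P` is the negation of the `Σ⁰₁` definition of its complement.
  have key' : ∀ n, SatPi1 (.not (η.subst (fun i => i) flattenSubst)) w (push n p) ↔ P n := by
    intro n
    simp only [SatPi1, BddFormula.Sat, BddFormula.sat_subst, val_flattenSubst, ← hη]
    rw [← not_exists, not_iff_comm]
    exact h' fun _ => n
  obtain ⟨X, hX, hX'⟩ := hS (θ.subst (fun i => i) flattenSubst)
    (.not (η.subst (fun i => i) flattenSubst)) w p hw (fun n => by rw [key, key'])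
  convert hX
  ext n
  rw [Set.mem_ofPred_eq, hX', key]

end Sigma1

end

/-! ### The first-order part is an ordered semiring -/

section

variable {M : Type u} [Zero M] [One M] [Add M] [Mul M] [LT M] {S : Set (Set M)}

namespace ModelsRCA0

/-- The semiring laws are inductions on one variable in an equation of terms, the other variables
being parameters. -/
lemma induct_eq (h : ModelsRCA0 S) (s t : M → M) [hs : TermFn fun v => s (v 0)]
    [ht : TermFn fun v => t (v 0)] (h0 : s 0 = t 0)
    (h1 : ∀ n, s n = t n → s (n + 1) = t (n + 1)) (n : M) : s n = t n :=
  h.induction.induct (P := fun n => s n = t n) (IsDelta0.eq h.sets_nonempty hs ht).sigma1 h0 h1 n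

lemma zero_add' (h : ModelsRCA0 S) (a : M) : 0 + a = a :=
  h.induct_eq (fun n => 0 + n) (fun n => n) (h.basic.add_zero 0)
    (fun n hn => by rw [h.basic.add_succ, hn]) a

lemma succ_add' (h : ModelsRCA0 S) (a b : M) : a + 1 + b = a + b + 1 :=
  h.induct_eq (fun n => a + 1 + n) (fun n => a + n + 1) (by simp only [h.basic.add_zero])
    (fun n hn => by rw [h.basic.add_succ, h.basic.add_succ, hn]) b

lemma add_comm' (h : ModelsRCA0 S) (a b : M) : a + b = b + a :=
  h.induct_eq (fun n => a + n) (fun n => n + a) (by rw [h.basic.add_zero, h.zero_add'])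
    (fun n hn => by rw [h.basic.add_succ, h.succ_add', hn]) b

lemma add_assoc' (h : ModelsRCA0 S) (a b c : M) : a + b + c = a + (b + c) :=
  h.induct_eq (fun n => a + b + n) (fun n => a + (b + n)) (by simp only [h.basic.add_zero])
    (fun n hn => by rw [h.basic.add_succ, h.basic.add_succ, h.basic.add_succ, hn]) c

lemma zero_mul' (h : ModelsRCA0 S) (a : M) : 0 * a = 0 :=
  h.induct_eq (fun n => 0 * n) (fun _ => 0) (h.basic.mul_zero 0)
    (fun n hn => by rw [h.basic.mul_succ, hn, h.basic.add_zero]) a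

lemma succ_mul' (h : ModelsRCA0 S) (a b : M) : (a + 1) * b = a * b + b :=
  h.induct_eq (fun n => (a + 1) * n) (fun n => a * n + n)
    (by simp only [h.basic.mul_zero, h.basic.add_zero])
    (fun n hn => by
      rw [h.basic.mul_succ, h.basic.mul_succ, hn, h.add_assoc', h.add_assoc', h.basic.add_succ,
        h.basic.add_succ, h.basic.add_succ, h.basic.add_succ, h.add_comm' n a]) b

lemma mul_comm' (h : ModelsRCA0 S) (a b : M) : a * b = b * a :=
  h.induct_eq (fun n => a * n) (fun n => n * a) (by rw [h.basic.mul_zero, h.zero_mul'])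
    (fun n hn => by rw [h.basic.mul_succ, h.succ_mul', hn]) b

lemma mul_one' (h : ModelsRCA0 S) (a : M) : a * 1 = a := by
  rw [← h.zero_add' 1, h.basic.mul_succ, h.basic.mul_zero, h.zero_add']

lemma left_distrib' (h : ModelsRCA0 S) (a b c : M) : a * (b + c) = a * b + a * c :=
  h.induct_eq (fun n => a * (b + n)) (fun n => a * b + a * n)
    (by simp only [h.basic.mul_zero, h.basic.add_zero])
    (fun n hn => by rw [h.basic.add_succ, h.basic.mul_succ, h.basic.mul_succ, hn, h.add_assoc']) c

lemma mul_assoc' (h : ModelsRCA0 S) (a b c : M) : a * b * c = a * (b * c) :=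
  h.induct_eq (fun n => a * b * n) (fun n => a * (b * n)) (by simp only [h.basic.mul_zero])
    (fun n hn => by rw [h.basic.mul_succ, h.basic.mul_succ, hn, h.left_distrib']) c

/-- The semiring of the first-order part. -/
abbrev toCommSemiring (h : ModelsRCA0 S) : CommSemiring M where
  add_assoc := h.add_assoc'
  zero_add := h.zero_add'
  add_zero := h.basic.add_zero
  add_comm := h.add_comm'
  nsmul := nsmulRec
  left_distrib := h.left_distrib'
  right_distrib a b c := by
    rw [h.mul_comm', h.left_distrib', h.mul_comm' c a, h.mul_comm' c b]
  zero_mul := h.zero_mul'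
  mul_zero := h.basic.mul_zero
  mul_assoc := h.mul_assoc'
  one_mul a := by rw [h.mul_comm', h.mul_one']
  mul_one := h.mul_one'
  mul_comm := h.mul_comm'

lemma add_right_cancel' (h : ModelsRCA0 S) {a b c : M} (hc : a + c = b + c) : a = b := by
  -- The implication is written as a disjunction, to which the closure lemmas for `IsDelta0` apply.
  refine h.induction.induct (P := fun n => ¬ (a + n = b + n) ∨ a = b)
    ((IsDelta0.eq h.sets_nonempty inferInstance inferInstance).not.or
      (IsDelta0.eq h.sets_nonempty inferInstance inferInstance)).sigma1 ?_ ?_ c |>.resolve_left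
      (not_not.2 hc)
  · rw [h.basic.add_zero, h.basic.add_zero]; tauto
  · intro n hn
    rw [h.basic.add_succ, h.basic.add_succ]
    refine hn.imp_left fun h1 h2 => h1 (h.basic.succ_inj _ _ h2)

lemma lt_add_succ (h : ModelsRCA0 S) (a c : M) : a < a + (c + 1) := by
  refine h.induction.induct (P := fun n => a < a + (n + 1))
    (IsDelta0.lt h.sets_nonempty inferInstance inferInstance).sigma1 ?_ ?_ c
  · rw [h.zero_add']; exact (h.basic.lt_succ _ _).2 (Or.inr rfl)
  · intro n hn
    rw [h.basic.add_succ]; exact (h.basic.lt_succ _ _).2 (Or.inl hn)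

/-- The axioms describe `<` only through `lt_succ`. Together with `lt_add_succ` this reduces the
order to addition, from which the order axioms follow. -/
lemma exists_of_lt (h : ModelsRCA0 S) (a b : M) (hab : a < b) : ∃ c, b = a + (c + 1) := by
  have : ¬ a < b ∨ ∃ c, b = a + (c + 1) := by
    refine h.induction.induct (P := fun n => ¬ a < n ∨ ∃ c, n = a + (c + 1))
      ⟨fun v => ¬ a < v 1 ∨ v 1 = a + (v 0 + 1),
        (IsDelta0.lt h.sets_nonempty inferInstance inferInstance).not.or
          (IsDelta0.eq h.sets_nonempty inferInstance inferInstance), ?_⟩ ?_ ?_ b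
    · intro v
      constructor
      · rintro (h | ⟨c, h⟩)
        exacts [⟨0, Or.inl h⟩, ⟨c, Or.inr h⟩]
      · rintro ⟨c, h⟩
        exact h.imp_right fun h => ⟨c, h⟩
    · exact Or.inl (h.basic.not_lt_zero _)
    · intro n hn
      rw [or_iff_not_imp_left, not_not, h.basic.lt_succ]
      rintro (h1 | rfl)
      · obtain ⟨c, hc⟩ := hn.resolve_left (not_not.2 h1)
        exact ⟨c + 1, by rw [h.basic.add_succ, ← hc]⟩
      · exact ⟨0, by rw [h.zero_add']⟩
  exact this.resolve_left (not_not.2 hab)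

lemma zero_or_succ (h : ModelsRCA0 S) (c : M) : c = 0 ∨ ∃ d, c = d + 1 := by
  refine h.induction.induct (P := fun n => n = 0 ∨ ∃ d, n = d + 1)
    ⟨fun v => v 1 = 0 ∨ v 1 = v 0 + 1,
      (IsDelta0.eq h.sets_nonempty inferInstance inferInstance).or
        (IsDelta0.eq h.sets_nonempty inferInstance inferInstance), fun v => ?_⟩ ?_ ?_ c
  · constructor
    · rintro (h | ⟨c, h⟩)
      exacts [⟨0, Or.inl h⟩, ⟨c, Or.inr h⟩]
    · rintro ⟨c, h⟩
      exact h.imp_right fun h => ⟨c, h⟩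
  · exact Or.inl rfl
  · exact fun n _ => Or.inr ⟨n, rfl⟩

lemma exists_add (h : ModelsRCA0 S) (a b : M) : ∃ c, b = a + c ∨ a = b + c := by
  refine h.induction.induct (P := fun n => ∃ c, n = a + c ∨ a = n + c)
      ⟨fun v => v 1 = a + v 0 ∨ a = v 1 + v 0,
        (IsDelta0.eq h.sets_nonempty inferInstance inferInstance).or
          (IsDelta0.eq h.sets_nonempty inferInstance inferInstance), fun _ => Iff.rfl⟩ ?_ ?_ b
  · exact ⟨a, Or.inr (h.zero_add' a).symm⟩
  · rintro n ⟨c, rfl | hc⟩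
    · exact ⟨c + 1, Or.inl (h.basic.add_succ _ _).symm⟩
    · rcases h.zero_or_succ c with rfl | ⟨d, rfl⟩
      · refine ⟨1, Or.inl ?_⟩
        rw [hc, h.basic.add_zero]
      · exact ⟨d, Or.inr (by rw [hc, h.succ_add', h.basic.add_succ])⟩

lemma exists_add_succ (h : ModelsRCA0 S) (a b : M) : a < b ↔ ∃ c, b = a + (c + 1) :=
  ⟨h.exists_of_lt a b, by rintro ⟨c, rfl⟩; exact h.lt_add_succ a c⟩

lemma lt_irrefl' (h : ModelsRCA0 S) (a : M) : ¬ a < a := by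
  intro ha
  obtain ⟨c, hc⟩ := h.exists_of_lt a a ha
  refine h.basic.succ_ne_zero c (h.add_right_cancel' (c := a) ?_)
  rw [h.zero_add', h.add_comm', ← hc]

lemma lt_trans' (h : ModelsRCA0 S) {a b c : M} (hab : a < b) (hbc : b < c) : a < c := by
  obtain ⟨d, rfl⟩ := h.exists_of_lt _ _ hab
  obtain ⟨e, rfl⟩ := h.exists_of_lt _ _ hbc
  refine (h.exists_add_succ _ _).2 ⟨d + 1 + e, ?_⟩
  rw [h.add_assoc' a (d + 1), h.basic.add_succ (d + 1)]

lemma lt_trichotomy' (h : ModelsRCA0 S) (a b : M) : a < b ∨ a = b ∨ b < a := by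
  obtain ⟨c, rfl | rfl⟩ := h.exists_add a b <;> rcases h.zero_or_succ c with rfl | ⟨d, rfl⟩
  · exact Or.inr (Or.inl (h.basic.add_zero a).symm)
  · exact Or.inl (h.lt_add_succ a d)
  · exact Or.inr (Or.inl (h.basic.add_zero b))
  · exact Or.inr (Or.inr (h.lt_add_succ b d))

open Classical in
/-- The order of the first-order part. -/
noncomputable abbrev toLinearOrder (h : ModelsRCA0 S) : LinearOrder M where
  le a b := a < b ∨ a = b
  le_refl a := Or.inr rfl
  le_trans a b c := by
    rintro (h1 | rfl) (h2 | rfl)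
    exacts [Or.inl (h.lt_trans' h1 h2), Or.inl h1, Or.inl h2, Or.inr rfl]
  lt_iff_le_not_ge a b := by
    constructor
    · refine fun hab => ⟨Or.inl hab, ?_⟩
      rintro (h1 | rfl)
      exacts [h.lt_irrefl' _ (h.lt_trans' hab h1), h.lt_irrefl' _ hab]
    · rintro ⟨h1 | rfl, h2⟩
      exacts [h1, (h2 (Or.inr rfl)).elim]
  le_antisymm a b := by
    rintro (h1 | rfl) (h2 | h2)
    exacts [(h.lt_irrefl' _ (h.lt_trans' h1 h2)).elim, h2.symm, rfl, rfl]
  le_total a b := by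
    rcases h.lt_trichotomy' a b with h1 | h1 | h1
    exacts [Or.inl (Or.inl h1), Or.inl (Or.inr h1), Or.inr (Or.inl h1)]
  toDecidableLE := Classical.decRel _

lemma le_iff_exists_add' (h : ModelsRCA0 S) (a b : M) : (a < b ∨ a = b) ↔ ∃ c, b = a + c := by
  constructor
  · rintro (h1 | rfl)
    · obtain ⟨c, hc⟩ := h.exists_of_lt a b h1
      exact ⟨_, hc⟩
    · exact ⟨0, (h.basic.add_zero a).symm⟩
  · rintro ⟨c, rfl⟩
    rcases h.zero_or_succ c with rfl | ⟨d, rfl⟩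
    exacts [Or.inr (h.basic.add_zero a).symm, Or.inl (h.lt_add_succ a d)]

lemma toCanonicallyOrderedAdd (h : ModelsRCA0 S) :
    @CanonicallyOrderedAdd M _ h.toLinearOrder.toLE :=
  let _ := h.toLinearOrder
  let _ := h.toCommSemiring
  { exists_add_of_le := fun {a b} hab => (h.le_iff_exists_add' a b).1 hab
    le_add_self := fun a b => (h.le_iff_exists_add' a _).2 ⟨b, add_comm _ _⟩
    le_self_add := fun a b => (h.le_iff_exists_add' a _).2 ⟨b, rfl⟩ }

lemma toIsStrictOrderedRing (h : ModelsRCA0 S) :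
    @IsStrictOrderedRing M h.toCommSemiring.toSemiring h.toLinearOrder.toPartialOrder := by
  let _ := h.toCommSemiring
  let _ := h.toLinearOrder
  have := h.toCanonicallyOrderedAdd
  have hpos : ∀ a : M, 0 < a → ∃ d, a = d + 1 := fun a ha => by
    obtain ⟨d, hd⟩ := h.exists_of_lt 0 a ha
    exact ⟨d, hd.trans (zero_add _)⟩
  have hadd : ∀ a b : M, a ≤ b → ∀ c, c + a ≤ c + b := fun a b hab c => by
    obtain ⟨d, rfl⟩ := (h.le_iff_exists_add' a b).1 hab
    exact (h.le_iff_exists_add' _ _).2 ⟨d, (add_assoc _ _ _).symm⟩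
  have hmul : ∀ a : M, 0 < a → ∀ b c, b < c → a * b < a * c := fun a ha b c hbc => by
    obtain ⟨d, rfl⟩ := hpos a ha
    obtain ⟨e, rfl⟩ := h.exists_of_lt b c hbc
    exact (h.exists_add_succ _ _).2 ⟨d * e + d + e, by ring⟩
  have h01 : (0 : M) < 1 := (h.exists_add_succ _ _).2 ⟨0, by ring⟩
  exact
    { add_le_add_left := fun a b hab c => by
        have := hadd a b hab c
        rwa [add_comm a, add_comm b]
      le_of_add_le_add_left := fun a b c hbc => by
        by_contra hcb
        obtain ⟨e, he⟩ := h.exists_of_lt c b (not_le.1 hcb)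
        refine not_lt.2 hbc ((h.exists_add_succ _ _).2 ⟨e, ?_⟩)
        rw [he, add_assoc]
      zero_le_one := h01.le
      exists_pair_ne := ⟨0, 1, h01.ne⟩
      mul_lt_mul_of_pos_left := fun a ha b c hbc => hmul a ha b c hbc
      mul_lt_mul_of_pos_right := fun a ha b c hbc => by
        have := hmul a ha b c hbc
        simpa only [mul_comm] using this }

end ModelsRCA0

end

/-- Discretely ordered semirings of nonnegative elements. -/
class DiscreteSemiring (M : Type u) [CommSemiring M] [LinearOrder M] : Prop extends
    IsStrictOrderedRing M, CanonicallyOrderedAdd M where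
  lt_add_one_iff' : ∀ a b : M, a < b + 1 ↔ a ≤ b

/-- `(M, S)` is a model of `RCA₀`. -/
class RCA {M : Type u} [Zero M] [One M] [Add M] [Mul M] [LT M] (S : Set (Set M)) : Prop where
  out : ModelsRCA0 S

section

variable {M : Type u} [CommSemiring M] [LinearOrder M] [DiscreteSemiring M]

lemma lt_succ {a b : M} : a < b + 1 ↔ a ≤ b := DiscreteSemiring.lt_add_one_iff' a b

lemma succ_le {a b : M} : a + 1 ≤ b ↔ a < b := by
  rw [← not_lt, lt_succ, not_le]

/-! ### Closure properties of `Σ⁰₁` and `Δ⁰₁` -/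

lemma IsSubst.const (v : ℕ → M) : IsSubst (fun _ : ℕ → M => v) :=
  ⟨fun i => .var (2 * i + 1), v, fun u i => by simp only [Term.val, mix_odd]⟩

variable {S : Set (Set M)}

/-- `Σ⁰₁` collection for a bounded-quantifier matrix. -/
lemma IsDelta0.collection [hS : RCA S] {R : (ℕ → M) → Prop} (hR : IsDelta0 S R) (v : ℕ → M)
    (a : M) (h : ∀ x, x < a → ∃ y, R (push y (push x v))) :
    ∃ b, ∀ x, x < a → ∃ y, y < b ∧ R (push y (push x v)) := by
  -- Induction on an initial segment `k` of `a`; the guard `x < a` makes the step trivial once `k`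
  -- has passed `a`.
  have key : ∀ k : M, ∃ b, ∀ x, x < k → x < a → ∃ y, y < b ∧ R (push y (push x v)) := by
    have hD : IsDelta0 S (fun u => ∀ x, x < u 1 → x < a → ∃ y, y < u 0 ∧
        R (push y (push x v))) := by
      have h1 := hR.comp (((IsSubst.const v).push fun u => u 1).push fun u => u 0)
      have h2 := h1.bex (TermFn.var 1)
      have h3 := (IsDelta0.lt hS.out.sets_nonempty (TermFn.var 0) (TermFn.const a)).not.or h2
      have h4 := h3.ball (TermFn.var 1)
      simpa only [push, ← imp_iff_not_or] using h4
    refine hS.out.induction.induct (P := fun k => ∃ b, ∀ x, x < k → x < a → ∃ y, y < b ∧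
        R (push y (push x v))) ⟨_, hD, fun u => Iff.rfl⟩
        ⟨0, fun x hx => absurd hx (not_lt_zero)⟩ ?_
    rintro k ⟨b, hb⟩
    by_cases hk : k < a
    · obtain ⟨y, hy⟩ := h k hk
      refine ⟨max b (y + 1), fun x hx hxa => ?_⟩
      rcases (lt_succ.1 hx).lt_or_eq with hx | rfl
      · obtain ⟨z, hz, hz'⟩ := hb x hx hxa
        exact ⟨z, lt_max_of_lt_left hz, hz'⟩
      · exact ⟨y, lt_max_of_lt_right (lt_succ.2 le_rfl), hy⟩
    · exact ⟨b, fun x hx hxa => hb x (hxa.trans_le (not_lt.1 hk)) hxa⟩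
  obtain ⟨b, hb⟩ := key a
  exact ⟨b, fun x hx => hb x hx hx⟩

/-- `P` is given by a `Δ⁰₁` formula with parameters. -/
class Delta1 (S : Set (Set M)) (P : (ℕ → M) → Prop) : Prop where
  pos : Sigma1 S P
  neg : Sigma1 S (fun v => ¬ P v)

lemma IsDelta0.delta1 {P : (ℕ → M) → Prop} (hP : IsDelta0 S P) : Delta1 S P :=
  ⟨hP.sigma1, hP.not.sigma1⟩

lemma Sigma1.congr {P Q : (ℕ → M) → Prop} (hP : Sigma1 S P) (h : ∀ v, P v ↔ Q v) : Sigma1 S Q := by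
  rwa [← funext fun v => propext (h v)]

lemma Delta1.congr {P Q : (ℕ → M) → Prop} (hP : Delta1 S P) (h : ∀ v, P v ↔ Q v) : Delta1 S Q := by
  rwa [← funext fun v => propext (h v)]

instance (priority := 200) Delta1.sigma1 {P : (ℕ → M) → Prop} [hP : Delta1 S P] : Sigma1 S P :=
  hP.pos

instance (priority := 300) Delta1.sigma1_not {P : (ℕ → M) → Prop} [hP : Delta1 S P] :
    Sigma1 S (fun v => ¬ P v) :=
  hP.neg

instance Delta1.mem {X : Set M} [hX : Fact (X ∈ S)] {t : (ℕ → M) → M} [ht : TermFn t] :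
    Delta1 S (fun v => t v ∈ X) :=
  (IsDelta0.mem hX.out ht).delta1

variable [hS : RCA S] {P Q : (ℕ → M) → Prop} {R : M → (ℕ → M) → Prop}

/-- The two existential quantifiers merge into a single bound for both witnesses, so no pairs need
decoding. Keeping the bound variable apart from the context, as in `R x v`, lets instance search
recognise quantified statements. -/
instance Sigma1.ex [hR : Sigma1 S (fun v => R (v 0) fun i => v (i + 1))] :
    Sigma1 S (fun v => ∃ x, R x v) := by
  obtain ⟨Q, hQ, h⟩ := hR.out
  refine ⟨fun v => ∃ x, x < v 0 ∧ ∃ y, y < v 0 ∧ Q (push y (push x fun i => v (i + 1))), ?_, ?_⟩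
  · have h1 := hQ.comp (((IsSubst.reindex fun i => i + 3).push fun u => u 1).push fun u => u 0)
    exact (h1.bex (TermFn.var 1)).bex (TermFn.var 0)
  · intro v
    constructor
    · rintro ⟨x, hx⟩
      obtain ⟨y, hy⟩ := (h (push x v)).1 hx
      exact ⟨max x y + 1, x, lt_succ.2 (le_max_left _ _), y, lt_succ.2 (le_max_right _ _), hy⟩
    · rintro ⟨b, x, -, y, -, hy⟩
      exact ⟨x, (h (push x v)).2 ⟨y, hy⟩⟩

instance Sigma1.and [hP : Sigma1 S P] [hQ : Sigma1 S Q] : Sigma1 S (fun v => P v ∧ Q v) := by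
  obtain ⟨A, hA, h1⟩ := hP.out
  obtain ⟨B, hB, h2⟩ := hQ.out
  have h3 : Sigma1 S (fun v => ∃ x y, A (push x v) ∧ B (push y v)) := by
    have h1 := hA.comp ((IsSubst.reindex fun i => i + 2).push fun u : ℕ → M => u 1)
    have h2 := hB.comp ((IsSubst.reindex fun i => i + 2).push fun u : ℕ → M => u 0)
    have := (h1.and h2).sigma1
    exact Sigma1.ex (R := fun x v => ∃ y, A (push x v) ∧ B (push y v))
      (hR := Sigma1.ex (R := fun y v => A (push (v 0) fun i => v (i + 1)) ∧
        B (push y fun i => v (i + 1))))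
  exact h3.congr fun v => by rw [h1, h2]; simp

instance Sigma1.or [hP : Sigma1 S P] [hQ : Sigma1 S Q] : Sigma1 S (fun v => P v ∨ Q v) := by
  obtain ⟨A, hA, h1⟩ := hP.out
  obtain ⟨B, hB, h2⟩ := hQ.out
  exact ⟨_, hA.or hB, fun v => by rw [h1, h2, exists_or]⟩

/-- Collection moves the unbounded quantifier in front of the bounded one. -/
instance Sigma1.ball {t : (ℕ → M) → M} [ht : TermFn t]
    [hR : Sigma1 S (fun v => R (v 0) fun i => v (i + 1))] :
    Sigma1 S (fun v => ∀ x, x < t v → R x v) := by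
  obtain ⟨Q, hQ, h⟩ := hR.out
  refine ⟨fun v => ∀ x, x < t (fun i => v (i + 1)) → ∃ y, y < v 0 ∧
    Q (push y (push x fun i => v (i + 1))), ?_, ?_⟩
  · have h1 := hQ.comp (((IsSubst.reindex fun i => i + 3).push fun u => u 1).push fun u => u 0)
    exact (h1.bex (TermFn.var 1)).ball (ht.comp (IsSubst.reindex fun i => i + 1))
  · intro v
    constructor
    · intro hv
      exact hQ.collection v (t v) fun x hx => (h (push x v)).1 (hv x hx)
    · rintro ⟨b, hb⟩ x hx
      obtain ⟨y, -, hy⟩ := hb x hx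
      exact (h (push x v)).2 ⟨y, hy⟩

instance Delta1.eq {s t : (ℕ → M) → M} [hs : TermFn s] [ht : TermFn t] :
    Delta1 S (fun v => s v = t v) :=
  (IsDelta0.eq hS.out.sets_nonempty hs ht).delta1

instance Delta1.lt {s t : (ℕ → M) → M} [hs : TermFn s] [ht : TermFn t] :
    Delta1 S (fun v => s v < t v) :=
  (IsDelta0.lt hS.out.sets_nonempty hs ht).delta1

instance Delta1.const {p : Prop} : Delta1 S (fun _ => p) := by
  by_cases hp : p
  · exact (Delta1.eq (s := fun _ => 0) (t := fun _ => 0)).congr fun _ => by simp [hp]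
  · exact (Delta1.eq (s := fun _ => 0) (t := fun _ => 1)).congr fun _ => by simp [hp]

instance Delta1.not [hP : Delta1 S P] : Delta1 S (fun v => ¬ P v) :=
  ⟨hP.neg, hP.pos.congr fun _ => not_not.symm⟩

instance Delta1.and [hP : Delta1 S P] [hQ : Delta1 S Q] : Delta1 S (fun v => P v ∧ Q v) :=
  ⟨inferInstance, (Sigma1.or (P := fun v => ¬ P v) (Q := fun v => ¬ Q v)).congr
    fun _ => not_and_or.symm⟩

instance Delta1.or [hP : Delta1 S P] [hQ : Delta1 S Q] : Delta1 S (fun v => P v ∨ Q v) :=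
  ⟨inferInstance, (Sigma1.and (P := fun v => ¬ P v) (Q := fun v => ¬ Q v)).congr
    fun _ => not_or.symm⟩

instance Sigma1.imp [hP : Delta1 S P] [hQ : Sigma1 S Q] : Sigma1 S (fun v => P v → Q v) :=
  (Sigma1.or (P := fun v => ¬ P v)).congr fun _ => imp_iff_not_or.symm

instance Delta1.imp [hP : Delta1 S P] [hQ : Delta1 S Q] : Delta1 S (fun v => P v → Q v) :=
  (Delta1.or (P := fun v => ¬ P v)).congr fun _ => imp_iff_not_or.symm

instance Delta1.iff [hP : Delta1 S P] [hQ : Delta1 S Q] : Delta1 S (fun v => P v ↔ Q v) :=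
  (Delta1.and (P := fun v => P v → Q v) (Q := fun v => Q v → P v)).congr
    fun _ => iff_iff_implies_and_implies.symm

lemma Delta1.comp (hP : Delta1 S P) {T : (ℕ → M) → ℕ → M} (hT : IsSubst T) :
    Delta1 S (fun v => P (T v)) :=
  ⟨hP.pos.comp hT, hP.neg.comp hT⟩

instance Delta1.bex {t : (ℕ → M) → M} [ht : TermFn t]
    [hR : Delta1 S (fun v => R (v 0) fun i => v (i + 1))] :
    Delta1 S (fun v => ∃ x, x < t v ∧ R x v) := by
  have h1 : Delta1 S (fun v => v 0 < t (fun i => v (i + 1))) :=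
    Delta1.lt (hs := TermFn.var 0) (ht := ht.comp (IsSubst.reindex fun i => i + 1))
  refine ⟨Sigma1.ex (R := fun x v => x < t v ∧ R x v), ?_⟩
  exact (Sigma1.ball (t := t) (R := fun x v => ¬ R x v)).congr fun v => by simp

instance Delta1.ball {t : (ℕ → M) → M} [ht : TermFn t]
    [hR : Delta1 S (fun v => R (v 0) fun i => v (i + 1))] :
    Delta1 S (fun v => ∀ x, x < t v → R x v) :=
  (Delta1.not (P := fun v => ∃ x, x < t v ∧ ¬ R x v)).congr fun v => by simp

instance Delta1.bex_le {t : (ℕ → M) → M} [ht : TermFn t]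
    [hR : Delta1 S (fun v => R (v 0) fun i => v (i + 1))] :
    Delta1 S (fun v => ∃ x, x ≤ t v ∧ R x v) :=
  have : Delta1 S (fun v => ∃ x, x < t v + 1 ∧ R x v) := inferInstance
  this.congr fun v => by simp only [lt_succ]

instance Delta1.ball_le {t : (ℕ → M) → M} [ht : TermFn t]
    [hR : Delta1 S (fun v => R (v 0) fun i => v (i + 1))] :
    Delta1 S (fun v => ∀ x, x ≤ t v → R x v) :=
  have : Delta1 S (fun v => ∀ x, x < t v + 1 → R x v) := inferInstance
  this.congr fun v => by simp only [lt_succ]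

lemma Delta1.comp₂ {P : M → M → Prop} (hP : Delta1 S fun v => P (v 0) (v 1)) (a b : (ℕ → M) → M)
    [TermFn a] [TermFn b] : Delta1 S (fun v => P (a v) (b v)) :=
  hP.comp ((IsSubst.id.push b).push a)

lemma Delta1.comp₃ {P : M → M → M → Prop} (hP : Delta1 S fun v => P (v 0) (v 1) (v 2))
    (a b c : (ℕ → M) → M) [TermFn a] [TermFn b] [TermFn c] :
    Delta1 S (fun v => P (a v) (b v) (c v)) :=
  hP.comp (((IsSubst.id.push c).push b).push a)

/-! ### Induction, least elements, collection and comprehension -/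

lemma sigma1_induction (S : Set (Set M)) [hS : RCA S] {P : M → Prop}
    [hP : Sigma1 S (fun v => P (v 0))] (h0 : P 0) (h1 : ∀ n, P n → P (n + 1)) (n : M) : P n :=
  hS.out.induction.induct hP h0 h1 n

/-- The induction is on "no `m < n` satisfies `P`", which is `Σ⁰₁` as soon as `¬ P` is. Thus `P` may
be `Π⁰₁`. -/
lemma exists_least (S : Set (Set M)) [hS : RCA S] {P : M → Prop}
    [hP : Sigma1 S (fun v => ¬ P (v 0))] (h : ∃ n, P n) : ∃ n, P n ∧ ∀ m, m < n → ¬ P m := by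
  by_contra! hn
  have key : ∀ n : M, ∀ m, m < n → ¬ P m := by
    have h2 : Sigma1 S (fun v => ∀ m, m < v 0 → ¬ P m) := by
      have := hP.comp (IsSubst.reindex fun _ => 0)
      exact Sigma1.ball (t := fun v => v 0) (R := fun m _ => ¬ P m)
    refine sigma1_induction S (P := fun n => ∀ m, m < n → ¬ P m) (fun m hm => absurd hm not_lt_zero) ?_
    intro n ih m hm hPm
    rcases (lt_succ.1 hm).lt_or_eq with hm | rfl
    · exact ih m hm hPm
    · obtain ⟨k, hk, hk'⟩ := hn m hPm
      exact ih k hk hk'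
  obtain ⟨n, hn⟩ := h
  exact key (n + 1) n (lt_succ.2 le_rfl) hn

lemma collection (S : Set (Set M)) [hS : RCA S] {P : M → M → Prop}
    [hP : Sigma1 S (fun v => P (v 1) (v 0))] (a : M) (h : ∀ x, x < a → ∃ y, P x y) :
    ∃ b, ∀ x, x < a → ∃ y, y < b ∧ P x y := by
  obtain ⟨Q, hQ, hPQ⟩ := hP.out
  have h1 : IsDelta0 S fun v => ∃ y, y < v 0 ∧ ∃ z, z < v 0 ∧
      Q (push z (push y (push (v 1) fun _ => 0))) := by
    have h1 := hQ.comp ((((IsSubst.const fun _ => 0).push fun u : ℕ → M => u 3).push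
      fun u => u 1).push fun u => u 0)
    exact (h1.bex (TermFn.var 1)).bex (TermFn.var 0)
  obtain ⟨b, hb⟩ := h1.collection (fun _ => 0) a fun x hx => by
    obtain ⟨y, hy⟩ := h x hx
    obtain ⟨z, hz⟩ := (hPQ (push y (push x fun _ => 0))).1 hy
    exact ⟨max y z + 1, y, lt_succ.2 (le_max_left _ _), z, lt_succ.2 (le_max_right _ _), hz⟩
  refine ⟨b, fun x hx => ?_⟩
  obtain ⟨c, hc, y, hy, z, -, hz⟩ := hb x hx
  exact ⟨y, lt_trans hy hc, (hPQ (push y (push x fun _ => 0))).2 ⟨z, hz⟩⟩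

lemma comprehension (S : Set (Set M)) [hS : RCA S] {P : M → Prop}
    [hP : Delta1 S (fun v => P (v 0))] : {n | P n} ∈ S :=
  hS.out.comprehension.exists_set hP.pos hP.neg

end

section

variable {M : Type u} [CommSemiring M] [LinearOrder M] [DiscreteSemiring M]

/-! ### Divisibility -/

/-- There is no subtraction, so the two quotients are compared; if that of the sum is not the larger
one, then `b = 0`. -/
lemma dvd_of_dvd_add {d a b : M} (ha : d ∣ a) (hab : d ∣ a + b) : d ∣ b := by
  obtain ⟨x, rfl⟩ := ha
  obtain ⟨y, hy⟩ := hab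
  rcases le_total x y with h | h
  · obtain ⟨z, rfl⟩ := exists_add_of_le h
    exact ⟨z, by rw [mul_add] at hy; exact add_left_cancel hy⟩
  · obtain ⟨z, rfl⟩ := exists_add_of_le h
    have : d * z + b = 0 := by
      rw [mul_add, add_assoc] at hy
      exact add_left_cancel (hy.trans (add_zero _).symm)
    rw [add_eq_zero.1 this |>.2]
    exact dvd_zero d

lemma le_mul_of_pos {d q : M} (hd : 0 < d) : q ≤ d * q := by
  have : 1 ≤ d := by simpa using succ_le.2 hd
  simpa using mul_le_mul_left this q

/-- The bound on the quotient makes divisibility a `Δ⁰₁` relation. -/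
lemma dvd_iff_exists_le {d n : M} : d ∣ n ↔ ∃ q, q ≤ n ∧ n = d * q := by
  constructor
  · rintro ⟨q, rfl⟩
    rcases eq_zero_or_pos d with rfl | hd
    · exact ⟨0, by simp, by simp⟩
    · exact ⟨q, le_mul_of_pos hd, rfl⟩
  · rintro ⟨q, -, rfl⟩
    exact dvd_mul_right _ _

/-- Gödel's coprimality argument in the form of Euclid's lemma: the two moduli differ by `m * (j -
i)`, and each is coprime to `m`, hence also to the divisor `j - i` of `m`. -/
lemma modulus_dvd_of_dvd_mul {m i j q : M} (hij : i < j) (hm : ∀ k, k < j → k + 1 ∣ m) :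
    (m * (j + 1) + 1 ∣ (m * (i + 1) + 1) * q → m * (j + 1) + 1 ∣ q) ∧
      (m * (i + 1) + 1 ∣ (m * (j + 1) + 1) * q → m * (i + 1) + 1 ∣ q) := by
  obtain ⟨e, rfl⟩ := exists_add_of_le (succ_le.2 hij)
  obtain ⟨f, hf⟩ := hm e (lt_add_of_pos_left e (by positivity))
  -- Coprimality to `m`: the modulus divides `m * k * x` and also `m * k * x + x`.
  have key : ∀ k x : M, m * k + 1 ∣ m * x → m * k + 1 ∣ x := fun k x hx => by
    have h1 : m * k + 1 ∣ m * k * x := by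
      have := hx.mul_left k
      rwa [← mul_assoc, mul_comm k] at this
    refine dvd_of_dvd_add h1 ⟨x, by ring⟩
  have key' : ∀ k, m * k + 1 ∣ m * (e + 1) * q → m * k + 1 ∣ q := fun k h => by
    have h1 := key k ((e + 1) * q) (by rwa [← mul_assoc])
    refine key k q ?_
    have h2 := h1.mul_left f
    rwa [← mul_assoc, mul_comm f, ← hf] at h2
  constructor
  · intro h
    refine key' _ (dvd_of_dvd_add h ⟨q, by ring⟩)
  · intro h
    refine key' _ (dvd_of_dvd_add (a := (m * (i + 1) + 1) * q) ⟨q, rfl⟩ ?_)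
    convert h using 1
    ring

variable {S : Set (Set M)} [hS : RCA S]

instance Delta1.dvd {s t : (ℕ → M) → M} [TermFn s] [TermFn t] :
    Delta1 S (fun v => s v ∣ t v) := by
  have : Delta1 S fun v : ℕ → M => ∃ q, q ≤ v 1 ∧ v 1 = v 0 * q := inferInstance
  exact Delta1.comp₂ (P := fun x y => x ∣ y) (this.congr fun v => dvd_iff_exists_le.symm) s t

instance Delta1.bit {s t r : (ℕ → M) → M} [TermFn s] [TermFn t] [TermFn r] :
    Delta1 S (fun v => Bit (s v) (t v) (r v)) :=
  inferInstanceAs (Delta1 S fun v => s v * (r v + 1) + 1 ∣ t v)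

/-! ### Coding of finite sets -/

lemma exists_common_multiple (S : Set (Set M)) [RCA S] (a b l : M) (hb : 0 < b) :
    ∃ N, 0 < N ∧ ∀ i, i < l → a * i + b ∣ N := by
  refine sigma1_induction S (P := fun l => ∃ N, 0 < N ∧ ∀ i, i < l → a * i + b ∣ N) ?_ ?_ l
  · exact ⟨b, hb, fun i hi => absurd hi not_lt_zero⟩
  · rintro l ⟨N, hN, h⟩
    refine ⟨N * (a * l + b), mul_pos hN (add_pos_of_nonneg_of_pos (by simp) hb), fun i hi => ?_⟩
    rcases (lt_succ.1 hi).lt_or_eq with hi | rfl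
    · exact (h i hi).mul_right _
    · exact dvd_mul_left _ _

/-- `m` and `N` are parameters for coding subsets of `{i | i < l}` by divisors of `N`. -/
structure IsModulus (l m N : M) : Prop where
  pos : 0 < m
  dvd : ∀ i, i < l → i + 1 ∣ m
  pos' : 0 < N
  dvd' : ∀ i, i < l → m * (i + 1) + 1 ∣ N

lemma isModulus_iff {l m N : M} : IsModulus l m N ↔ 0 < m ∧ (∀ i, i < l → i + 1 ∣ m) ∧
    0 < N ∧ ∀ i, i < l → m * (i + 1) + 1 ∣ N :=
  ⟨fun h => ⟨h.1, h.2, h.3, h.4⟩, fun h => ⟨h.1, h.2.1, h.2.2.1, h.2.2.2⟩⟩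

instance Delta1.isModulus {s t r : (ℕ → M) → M} [TermFn s] [TermFn t] [TermFn r] :
    Delta1 S (fun v => IsModulus (s v) (t v) (r v)) := by
  have : Delta1 S fun v : ℕ → M => 0 < v 1 ∧ (∀ i, i < v 0 → i + 1 ∣ v 1) ∧
    0 < v 2 ∧ ∀ i, i < v 0 → v 1 * (i + 1) + 1 ∣ v 2 := inferInstance
  exact Delta1.comp₃ (P := IsModulus) (this.congr fun v => isModulus_iff.symm) s t r

lemma exists_isModulus (S : Set (Set M)) [RCA S] (l : M) : ∃ m N, IsModulus l m N := by
  obtain ⟨m, hm, h⟩ := exists_common_multiple S 1 1 l zero_lt_one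
  obtain ⟨N, hN, h'⟩ := exists_common_multiple S m (m + 1) l (by positivity)
  refine ⟨m, N, hm, fun i hi => by simpa using h i hi, hN, fun i hi => ?_⟩
  convert h' i hi using 1
  ring

variable (S) in
/-- Bounded `Σ⁰₁` comprehension, for coded finite sets. -/
lemma IsModulus.exists_code {l m N : M} (h : IsModulus l m N) (P : M → Prop)
    [hP : Sigma1 S fun v => P (v 0)] : ∃ n, n ≤ N ∧ ∀ i, i < l → (Bit m n i ↔ P i) := by
  have h1 : Sigma1 S fun v => ¬ (0 < v 0 ∧ ∀ i, i < l → P i → m * (i + 1) + 1 ∣ v 0) := by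
    have h2 : Sigma1 S fun v => ¬ 0 < v 0 ∨ ∃ i, i < l ∧ P i ∧ ¬ m * (i + 1) + 1 ∣ v 0 := by
      have := hP.comp (IsSubst.reindex fun _ => 0)
      infer_instance
    refine h2.congr fun v => ?_
    push Not
    rw [imp_iff_not_or, not_lt]
  -- The code is the least positive number divisible by all moduli with index in `P`. Since `P`
  -- occurs as a premise, this property is `Π⁰₁`.
  obtain ⟨n, ⟨hn, hn'⟩, hmin⟩ := exists_least S
    (P := fun n => 0 < n ∧ ∀ i, i < l → P i → m * (i + 1) + 1 ∣ n)
    ⟨N, h.pos', fun i hi _ => h.dvd' i hi⟩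
  refine ⟨n, le_of_not_gt fun hN => hmin N hN ⟨h.pos', fun i hi _ => h.dvd' i hi⟩,
    fun i hi => ⟨fun hb => ?_, hn' i hi⟩⟩
  by_contra hPi
  obtain ⟨q, rfl⟩ := hb
  -- If a superfluous modulus divided `n`, the quotient `q` would be smaller and, by coprimality,
  -- still divisible by all required moduli.
  have hq : 0 < q := pos_of_mul_pos_right hn (by simp)
  refine hmin q ?_ ⟨hq, fun j hj hPj => ?_⟩
  · rw [add_mul, one_mul]
    exact lt_add_of_pos_left q (mul_pos (mul_pos h.pos (by positivity)) hq)
  · have hij : i ≠ j := by rintro rfl; exact hPi hPj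
    rcases hij.lt_or_gt with hij | hij
    · exact (modulus_dvd_of_dvd_mul hij fun k hk => h.dvd k (hk.trans hj)).1 (hn' j hj hPj)
    · exact (modulus_dvd_of_dvd_mul hij fun k hk => h.dvd k (hk.trans hi)).2 (hn' j hj hPj)

end

section

variable {M : Type u} [CommSemiring M] [LinearOrder M] [DiscreteSemiring M]

/-! ### Pairing -/

/-- `pair x y` lies between the square of `x + y` and that of `x + y + 1`, so a code determines the
sum. -/
lemma pair_lt_of_add_lt {x y x' y' : M} (h : x + y < x' + y') : pair x y < pair x' y' := by
  obtain ⟨e, he⟩ := exists_add_of_le (succ_le.2 h)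
  unfold pair
  rw [he]
  have h1 : (x + y + 1 + e) * (x + y + 1 + e) + x' =
      ((x + y) * (x + y) + x) + (y + 1 + (x + y) + (e * e + 2 * e * (x + y + 1) + x')) := by ring
  rw [h1]
  exact lt_add_of_pos_right _ (by positivity)

lemma pair_inj {x y x' y' : M} (h : pair x y = pair x' y') : x = x' ∧ y = y' := by
  rcases lt_trichotomy (x + y) (x' + y') with h1 | h1 | h1
  · exact absurd h (pair_lt_of_add_lt h1).ne
  · unfold pair at h
    rw [h1] at h
    obtain rfl := add_left_cancel h
    exact ⟨rfl, add_left_cancel h1⟩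
  · exact absurd h (pair_lt_of_add_lt h1).ne'

lemma left_le_pair (x y : M) : x ≤ pair x y := le_add_self

lemma le_mul_self' (a : M) : a ≤ a * a := by
  rcases eq_zero_or_pos a with rfl | h
  · simp
  · exact le_mul_of_pos h

lemma right_le_pair (x y : M) : y ≤ pair x y :=
  (le_add_self.trans (le_mul_self' (x + y))).trans le_self_add

lemma pair_le_pair {x y x' y' : M} (hx : x ≤ x') (hy : y ≤ y') : pair x y ≤ pair x' y' := by
  unfold pair
  gcongr

lemma triple_inj {l m n l' m' n' : M} (h : triple l m n = triple l' m' n') :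
    l = l' ∧ m = m' ∧ n = n' := by
  obtain ⟨h1, h2⟩ := pair_inj h
  obtain ⟨h3, h4⟩ := pair_inj h1
  exact ⟨h3, h4, h2⟩

lemma fst_le_triple (l m n : M) : l ≤ triple l m n :=
  (left_le_pair l m).trans (left_le_pair _ n)

lemma snd_le_triple (l m n : M) : m ≤ triple l m n :=
  (right_le_pair l m).trans (left_le_pair _ n)

lemma thd_le_triple (l m n : M) : n ≤ triple l m n :=
  right_le_pair _ n

instance TermFn.pair' {s t : (ℕ → M) → M} [TermFn s] [TermFn t] :
    TermFn (fun v => SecondOrderArith.pair (s v) (t v)) :=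
  inferInstanceAs (TermFn fun v => (s v + t v) * (s v + t v) + s v)

instance TermFn.triple {s t r : (ℕ → M) → M} [TermFn s] [TermFn t] [TermFn r] :
    TermFn (fun v => SecondOrderArith.triple (s v) (t v) (r v)) :=
  inferInstanceAs (TermFn fun v => SecondOrderArith.pair (SecondOrderArith.pair (s v) (t v)) (r v))

/-! ### Strings -/

lemma HasLength.unique {σ l l' : M} (h : HasLength σ l) (h' : HasLength σ l') : l = l' := by
  obtain ⟨m, n, rfl⟩ := h
  obtain ⟨m', n', h'⟩ := h'
  exact (triple_inj h').1

lemma HasLength.le {σ l : M} (h : HasLength σ l) : l ≤ σ := by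
  obtain ⟨m, n, rfl⟩ := h
  exact fst_le_triple l m n

lemma IsString.exists_length {σ : M} (h : IsString σ) : ∃ l, HasLength σ l := by
  obtain ⟨l, m, n, h, -⟩ := h
  exact ⟨l, m, n, h⟩

lemma hasValue_triple {l m n i c : M} : HasValue (triple l m n) i c ↔
    i < l ∧ ((Bit m n i ∧ c = 1) ∨ (¬ Bit m n i ∧ c = 0)) := by
  constructor
  · rintro ⟨l', m', n', h, hi⟩
    obtain ⟨rfl, rfl, rfl⟩ := triple_inj h
    exact hi
  · exact fun h => ⟨l, m, n, rfl, h⟩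

lemma hasValue_one_triple {l m n i : M} (hi : i < l) : HasValue (triple l m n) i 1 ↔ Bit m n i := by
  rw [hasValue_triple]
  simp [hi]

lemma HasLength.hasValue_zero {σ l i : M} (h : HasLength σ l) (hi : i < l) :
    HasValue σ i 0 ↔ ¬ HasValue σ i 1 := by
  obtain ⟨m, n, rfl⟩ := h
  simp [hasValue_triple, hi]

/-- A prefix is determined by the length and the positions of the ones. -/
lemma HasLength.isPrefix {σ τ l k : M} (hσ : HasLength σ l) (hτ : HasLength τ k) (hkl : k ≤ l)
    (h : ∀ i, i < k → (HasValue τ i 1 ↔ HasValue σ i 1)) : IsPrefix τ σ := by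
  obtain ⟨m, n, rfl⟩ := hσ
  obtain ⟨m', n', rfl⟩ := hτ
  rintro i c hi
  rw [hasValue_triple] at hi ⊢
  have := h i hi.1
  rw [hasValue_one_triple hi.1, hasValue_one_triple (hi.1.trans_le hkl)] at this
  rw [← this]
  exact ⟨hi.1.trans_le hkl, hi.2⟩

variable {S : Set (Set M)} [hS : RCA S]

instance Delta1.hasLength {s t : (ℕ → M) → M} [TermFn s] [TermFn t] :
    Delta1 S (fun v => HasLength (s v) (t v)) := by
  have : Delta1 S fun v : ℕ → M => ∃ m, m ≤ v 0 ∧ ∃ n, n ≤ v 0 ∧ v 0 = triple (v 1) m n :=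
    inferInstance
  refine Delta1.comp₂ (P := HasLength) (this.congr fun v => ⟨?_, ?_⟩) s t
  · rintro ⟨m, -, n, -, h⟩
    exact ⟨m, n, h⟩
  · rintro ⟨m, n, h⟩
    rw [h]
    exact ⟨m, snd_le_triple _ _ _, n, thd_le_triple _ _ _, rfl⟩

instance Delta1.hasValue {s t r : (ℕ → M) → M} [TermFn s] [TermFn t] [TermFn r] :
    Delta1 S (fun v => HasValue (s v) (t v) (r v)) := by
  have : Delta1 S fun v : ℕ → M => ∃ l, l ≤ v 0 ∧ ∃ m, m ≤ v 0 ∧ ∃ n, n ≤ v 0 ∧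
      v 0 = triple l m n ∧ v 1 < l ∧ ((Bit m n (v 1) ∧ v 2 = 1) ∨ (¬ Bit m n (v 1) ∧ v 2 = 0)) :=
    inferInstance
  refine Delta1.comp₃ (P := HasValue) (this.congr fun v => ⟨?_, ?_⟩) s t r
  · rintro ⟨l, -, m, -, n, -, h⟩
    exact ⟨l, m, n, h⟩
  · rintro ⟨l, m, n, h, h'⟩
    refine ⟨l, ?_, m, ?_, n, ?_, h, h'⟩ <;> rw [h]
    exacts [fst_le_triple _ _ _, snd_le_triple _ _ _, thd_le_triple _ _ _]

/-- The string is the least code with the given bits; bounding the components by the code keeps the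
condition `Δ⁰₁`. -/
lemma exists_string_of_bit (S : Set (Set M)) [RCA S] (l m n : M) :
    ∃ σ, IsString σ ∧ HasLength σ l ∧ ∀ i, i < l → (HasValue σ i 1 ↔ Bit m n i) := by
  have : Delta1 S fun v => ∃ m', m' ≤ v 0 ∧ ∃ n', n' ≤ v 0 ∧ v 0 = triple l m' n' ∧
      ∀ i, i < l → (Bit m' n' i ↔ Bit m n i) := inferInstance
  obtain ⟨σ, ⟨m', -, n', -, rfl, h⟩, hmin⟩ := exists_least S (P := fun σ => ∃ m', m' ≤ σ ∧
      ∃ n', n' ≤ σ ∧ σ = triple l m' n' ∧ ∀ i, i < l → (Bit m' n' i ↔ Bit m n i))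
      ⟨triple l m n, m, snd_le_triple _ _ _, n, thd_le_triple _ _ _, rfl, fun _ _ => Iff.rfl⟩
  refine ⟨_, ⟨l, m', n', rfl, fun m'' n'' h' hlt => ?_⟩, ⟨m', n', rfl⟩, fun i hi => ?_⟩
  · exact hmin _ hlt ⟨m'', snd_le_triple _ _ _, n'', thd_le_triple _ _ _, rfl,
      fun i hi => (h' i hi).trans (h i hi)⟩
  · rw [hasValue_one_triple hi, h i hi]

variable (S) in
lemma exists_string (P : M → Prop) [Sigma1 S fun v => P (v 0)] (l : M) :
    ∃ σ, IsString σ ∧ HasLength σ l ∧ ∀ i, i < l → (HasValue σ i 1 ↔ P i) := by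
  obtain ⟨m, N, h⟩ := exists_isModulus S l
  obtain ⟨n, -, hn⟩ := h.exists_code S P
  obtain ⟨σ, h1, h2, h3⟩ := exists_string_of_bit S l m n
  exact ⟨σ, h1, h2, fun i hi => (h3 i hi).trans (hn i hi)⟩

/-- Strings of bounded length have bounded codes. -/
lemma IsModulus.string_le (S : Set (Set M)) [RCA S] {l m N σ k : M} (h : IsModulus l m N)
    (hσ : IsString σ) (hk : HasLength σ k) (hkl : k ≤ l) : σ ≤ triple l m N := by
  obtain ⟨k', m', n', rfl, hmin⟩ := hσ
  obtain rfl : k' = k := HasLength.unique ⟨m', n', rfl⟩ hk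
  have : Delta1 S fun v => Bit m' n' (v 0) := inferInstance
  -- The same bits are coded again with modulus `m` and a number `n ≤ N`; a string is its own least
  -- code, so it lies below this one.
  obtain ⟨n, hn, hn'⟩ := h.exists_code S (Bit m' n')
  have h1 := not_lt.1 (hmin m n fun i hi => hn' i (hi.trans_le hkl))
  refine h1.trans ?_
  exact pair_le_pair (pair_le_pair hkl le_rfl) hn

/-! ### Trees -/

/-- `σ` is an element of `T` of length `l`. -/
def Level (T : Set M) (l σ : M) : Prop := σ ∈ T ∧ HasLength σ l

/-- `σ` and `τ` have the same entries below `k`. -/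
def Agree (k σ τ : M) : Prop := ∀ i, i < k → (HasValue σ i 1 ↔ HasValue τ i 1)

instance Delta1.agree {s t r : (ℕ → M) → M} [TermFn s] [TermFn t] [TermFn r] :
    Delta1 S (fun v => Agree (s v) (t v) (r v)) := by
  have : Delta1 S fun v : ℕ → M => ∀ i, i < v 0 → (HasValue (v 1) i 1 ↔ HasValue (v 2) i 1) :=
    inferInstance
  exact Delta1.comp₃ (P := Agree) this s t r

instance Delta1.level {T : Set M} [Fact (T ∈ S)] {s t : (ℕ → M) → M} [TermFn s] [TermFn t] :
    Delta1 S (fun v => Level T (s v) (t v)) :=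
  inferInstanceAs (Delta1 S fun v => t v ∈ T ∧ HasLength (t v) (s v))

lemma Agree.symm {k σ τ : M} (h : Agree k σ τ) : Agree k τ σ := fun i hi => (h i hi).symm

lemma Agree.trans {k σ τ ρ : M} (h : Agree k σ τ) (h' : Agree k τ ρ) : Agree k σ ρ :=
  fun i hi => (h i hi).trans (h' i hi)

lemma Agree.mono {k j σ τ : M} (h : Agree k σ τ) (hjk : j ≤ k) : Agree j σ τ :=
  fun i hi => h i (hi.trans_le hjk)

variable {T : Set M}

/-- A string that agrees with an element of a level of the tree above its length is in the tree. -/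
lemma IsBinaryTree.level_of_agree (hT : IsBinaryTree T) {l k σ τ : M} (hσ : Level T l σ)
    (hτ : IsString τ) (hk : HasLength τ k) (hkl : k ≤ l) (h : Agree k τ σ) : Level T k τ :=
  ⟨hT.closed σ hσ.1 τ hτ (hσ.2.isPrefix hk hkl h), hk⟩

lemma IsBinaryTree.exists_truncate (S : Set (Set M)) [RCA S] (hT : IsBinaryTree T) {l k σ : M}
    (hσ : Level T l σ) (hkl : k ≤ l) : ∃ τ, Level T k τ ∧ Agree k τ σ := by
  have : Delta1 S fun v => HasValue σ (v 0) 1 := inferInstance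
  obtain ⟨τ, h1, h2, h3⟩ := exists_string S (fun i => HasValue σ i 1) k
  exact ⟨τ, hT.level_of_agree hσ h1 h2 hkl h3, h3⟩

/-- Strings of length at most `l` have bounded codes, so an element of `T` beyond the bound is
longer than `l` and can be truncated. -/
lemma IsBinaryTree.exists_level (S : Set (Set M)) [RCA S] (hT : IsBinaryTree T)
    (hi : Infinite T) (l : M) : ∃ σ, Level T l σ := by
  obtain ⟨m, N, h⟩ := exists_isModulus S l
  obtain ⟨σ, hσ, hlt⟩ := hi (triple l m N)
  obtain ⟨k, hk⟩ := (hT.strings σ hσ).exists_length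
  have hlk : l ≤ k := le_of_not_ge fun hkl =>
    (h.string_le S (hT.strings σ hσ) hk hkl).not_gt hlt
  obtain ⟨τ, hτ, -⟩ := hT.exists_truncate S ⟨hσ, hk⟩ hlk
  exact ⟨τ, hτ⟩

lemma IsBinaryTree.level_le (S : Set (Set M)) [RCA S] (hT : IsBinaryTree T) {l m N σ : M}
    (h : IsModulus l m N) (hσ : Level T l σ) : σ ≤ triple l m N :=
  h.string_le S (hT.strings σ hσ.1) hσ.2 le_rfl

/-- Quantification over a level of a tree is bounded quantification. -/
instance Delta1.forall_level [hT : Fact (IsBinaryTree T)] [Fact (T ∈ S)]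
    {t : (ℕ → M) → M} [ht : TermFn t] {R : M → (ℕ → M) → Prop}
    [hR : Delta1 S (fun v => R (v 0) fun i => v (i + 1))] :
    Delta1 S (fun v => ∀ σ, Level T (t v) σ → R σ v) := by
  have h1 : TermFn fun v => t fun i => v (i + 1) := ht.comp (IsSubst.reindex fun i => i + 1)
  have h2 : TermFn fun v => t fun i => v (i + 2) := ht.comp (IsSubst.reindex fun i => i + 2)
  have h3 : TermFn fun v => t fun i => v (i + 3) := ht.comp (IsSubst.reindex fun i => i + 3)
  have hR' : Delta1 S fun v => R (v 0) fun i => v (i + 3) :=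
    hR.comp ((IsSubst.reindex fun i => i + 3).push fun v => v 0)
  constructor
  -- A modulus bounds the codes on the level. It is quantified existentially, as no term provides
  -- it.
  · have : Sigma1 S fun v => ∃ m N, IsModulus (t v) m N ∧
        ∀ σ, σ ≤ triple (t v) m N → Level T (t v) σ → R σ v := inferInstance
    refine this.congr fun v => ⟨?_, fun h => ?_⟩
    · rintro ⟨m, N, hm, h⟩ σ hσ
      exact h σ (hT.out.level_le S hm hσ) hσ
    · obtain ⟨m, N, hm⟩ := exists_isModulus S (t v)
      exact ⟨m, N, hm, fun σ _ => h σ⟩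
  · have : Sigma1 S fun v => ∃ σ, Level T (t v) σ ∧ ¬ R σ v := by
      have h4 : Delta1 S fun v => ¬ R (v 0) fun i => v (i + 1) := inferInstance
      infer_instance
    exact this.congr fun v => by push Not; rfl

instance Delta1.exists_level [hT : Fact (IsBinaryTree T)] [Fact (T ∈ S)]
    {t : (ℕ → M) → M} [ht : TermFn t] {R : M → (ℕ → M) → Prop}
    [hR : Delta1 S (fun v => R (v 0) fun i => v (i + 1))] :
    Delta1 S (fun v => ∃ σ, Level T (t v) σ ∧ R σ v) := by
  have : Delta1 S fun v => ¬ ∀ σ, Level T (t v) σ → ¬ R σ v := inferInstance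
  exact this.congr fun v => by push Not; rfl

end

section

variable {M : Type u} [CommSemiring M] [LinearOrder M] [DiscreteSemiring M]

/-! ### The leftmost elements of the levels of a tree -/

/-- `τ` precedes `σ` in the lexicographic order of the strings of length `s`. -/
def LexLt (s τ σ : M) : Prop :=
  ∃ d, d < s ∧ Agree d τ σ ∧ ¬ HasValue τ d 1 ∧ HasValue σ d 1

/-- `σ` is the lexicographically least element of `T` of length `s`. -/
def Leftmost (T : Set M) (s σ : M) : Prop :=
  Level T s σ ∧ ∀ τ, Level T s τ → ¬ LexLt s τ σ

/-- The leftmost element of `T` of length `s` has value `1` at `x`. -/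
def LeftmostBit (T : Set M) (x s : M) : Prop :=
  ∃ σ, Level T s σ ∧ (∀ τ, Level T s τ → ¬ LexLt s τ σ) ∧ HasValue σ x 1

variable {S : Set (Set M)} [hS : RCA S] {T : Set M}

instance Delta1.lexLt {s t r : (ℕ → M) → M} [TermFn s] [TermFn t] [TermFn r] :
    Delta1 S (fun v => LexLt (s v) (t v) (r v)) := by
  have : Delta1 S fun v : ℕ → M => ∃ d, d < v 0 ∧ Agree d (v 1) (v 2) ∧ ¬ HasValue (v 1) d 1 ∧
    HasValue (v 2) d 1 := inferInstance
  exact Delta1.comp₃ (P := LexLt) this s t r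

instance Delta1.leftmostBit [Fact (IsBinaryTree T)] [Fact (T ∈ S)] {s t : (ℕ → M) → M} [TermFn s]
    [TermFn t] : Delta1 S (fun v => LeftmostBit T (s v) (t v)) := by
  have : Delta1 S fun v : ℕ → M => ∃ σ, Level T (v 1) σ ∧
    ((∀ τ, Level T (v 1) τ → ¬ LexLt (v 1) τ σ) ∧ HasValue σ (v 0) 1) := inferInstance
  exact Delta1.comp₂ (P := LeftmostBit T) this s t

/-- Induction on `j`: the current string is not beaten at any position below `j`. If it is beaten at
`j`, it is replaced by the string that beats it, which agrees with it below `j`. -/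
lemma exists_leftmost (S : Set (Set M)) [RCA S] [hT : Fact (IsBinaryTree T)] [Fact (T ∈ S)]
    (hi : Infinite T) (s : M) : ∃ σ, Leftmost T s σ := by
  have h1 : Delta1 S fun v => ∃ σ, Level T s σ ∧ ∀ τ, Level T s τ →
      ¬ ∃ d, d < v 0 ∧ Agree d τ σ ∧ ¬ HasValue τ d 1 ∧ HasValue σ d 1 := inferInstance
  refine sigma1_induction S (P := fun j => ∃ σ, Level T s σ ∧ ∀ τ, Level T s τ →
      ¬ ∃ d, d < j ∧ Agree d τ σ ∧ ¬ HasValue τ d 1 ∧ HasValue σ d 1) ?_ ?_ s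
  · obtain ⟨σ, hσ⟩ := hT.out.exists_level S hi s
    exact ⟨σ, hσ, fun τ _ ⟨d, hd, _⟩ => not_lt_zero hd⟩
  · rintro j ⟨σ, hσ, h⟩
    by_cases hj : ∃ τ, Level T s τ ∧ Agree j τ σ ∧ ¬ HasValue τ j 1 ∧ HasValue σ j 1
    · obtain ⟨τ, hτ, hag, h0, -⟩ := hj
      refine ⟨τ, hτ, ?_⟩
      rintro ρ hρ ⟨d, hd, hagd, hd0, hd1⟩
      rcases (lt_succ.1 hd).lt_or_eq with hd | rfl
      · exact h ρ hρ ⟨d, hd, hagd.trans (hag.mono hd.le), hd0, (hag d hd).1 hd1⟩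
      · exact h0 hd1
    · refine ⟨σ, hσ, ?_⟩
      rintro ρ hρ ⟨d, hd, hd'⟩
      rcases (lt_succ.1 hd).lt_or_eq with hd | rfl
      · exact h ρ hρ ⟨d, hd, hd'⟩
      · exact hj ⟨ρ, hρ, hd'⟩

/-- Two leftmost strings agree below `k` if their restrictions to `k` are extendible to the length
of the other string. -/
lemma Leftmost.agree (S : Set (Set M)) [RCA S] {s t k σ τ : M} (hσ : Leftmost T s σ)
    (hτ : Leftmost T t τ) (hs : k ≤ s) (ht : k ≤ t) (h : ∃ ρ, Level T t ρ ∧ Agree k ρ σ)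
    (h' : ∃ ρ, Level T s ρ ∧ Agree k ρ τ) : Agree k σ τ := by
  by_contra hn
  have hn' : ∃ d, d < k ∧ ¬ (HasValue σ d 1 ↔ HasValue τ d 1) := by
    simpa only [Agree, not_forall, exists_prop] using hn
  have : Delta1 S fun v => v 0 < k ∧ ¬ (HasValue σ (v 0) 1 ↔ HasValue τ (v 0) 1) := inferInstance
  obtain ⟨d, ⟨hdk, hd⟩, hmin⟩ := exists_least S
    (P := fun d => d < k ∧ ¬ (HasValue σ d 1 ↔ HasValue τ d 1)) hn'
  have hag : Agree d σ τ := fun i hi => by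
    by_contra hni
    exact hmin i hi ⟨hi.trans hdk, hni⟩
  -- At the least difference `d`, the string with a `1` is beaten at its own length by an extension
  -- of the other one's restriction.
  by_cases hb : HasValue σ d 1
  · have hb' : ¬ HasValue τ d 1 := fun h1 => hd (iff_of_true hb h1)
    obtain ⟨ρ, hρ, hρ'⟩ := h'
    exact hσ.2 ρ hρ ⟨d, hdk.trans_le hs, (hρ'.mono hdk.le).trans hag.symm,
      fun h1 => hb' ((hρ' d hdk).1 h1), hb⟩
  · have hb' : HasValue τ d 1 := by tauto
    obtain ⟨ρ, hρ, hρ'⟩ := h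
    exact hτ.2 ρ hρ ⟨d, hdk.trans_le ht, (hρ'.mono hdk.le).trans hag,
      fun h1 => hb ((hρ' d hdk).1 h1), hb'⟩

lemma Leftmost.leftmostBit_iff (S : Set (Set M)) [RCA S] {s x σ : M} (hσ : Leftmost T s σ)
    (hx : x < s) : LeftmostBit T x s ↔ HasValue σ x 1 := by
  refine ⟨?_, fun h => ⟨σ, hσ.1, hσ.2, h⟩⟩
  rintro ⟨τ, h1, h2, h3⟩
  exact (hσ.agree S (τ := τ) ⟨h1, h2⟩ le_rfl le_rfl ⟨σ, hσ.1, fun _ _ => Iff.rfl⟩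
    ⟨τ, h1, fun _ _ => Iff.rfl⟩ x hx).2 h3

/-- Strong `Σ⁰₁` collection. -/
lemma strong_collection (S : Set (Set M)) [RCA S] {P : M → M → Prop}
    [hP : Delta1 S (fun v => P (v 1) (v 0))] (a : M) :
    ∃ b, ∀ x, x < a → (∃ y, P x y) → ∃ y, y < b ∧ P x y := by
  obtain ⟨m, N, hm⟩ := exists_isModulus S a
  have h1 : Sigma1 S fun v => ∃ y, P (v 0) y := by
    have : Delta1 S fun v => P (v 1) (v 0) := hP
    infer_instance
  -- The set of those `x < a` that have a witness is coded by `n`; with this decidable guard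
  -- ordinary collection applies.
  obtain ⟨n, -, hn⟩ := hm.exists_code S fun x => ∃ y, P x y
  obtain ⟨b, hb⟩ := collection S (P := fun x y => Bit m n x → P x y) a fun x hx => by
    by_cases h : Bit m n x
    · obtain ⟨y, hy⟩ := (hn x hx).1 h
      exact ⟨y, fun _ => hy⟩
    · exact ⟨0, fun h' => absurd h' h⟩
  refine ⟨b, fun x hx h => ?_⟩
  obtain ⟨y, hy, hy'⟩ := hb x hx
  exact ⟨y, hy, hy' ((hn x hx).2 h)⟩

/-- If a string of length `k` dies, it dies before `b`. A restriction to `k` of a string longer than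
`b` has not died there, so it extends to every level, and `Leftmost.agree` applies. -/
lemma leftmost_stable (S : Set (Set M)) [RCA S] [hT : Fact (IsBinaryTree T)] [Fact (T ∈ S)]
    (k : M) : ∃ n, ∀ s t σ τ, n < s → n < t → Leftmost T s σ → Leftmost T t τ → Agree k σ τ := by
  obtain ⟨m, N, hm⟩ := exists_isModulus S k
  have h1 : Delta1 S fun v => k < v 0 ∧ ¬ ∃ ρ, Level T (v 0) ρ ∧ Agree k ρ (v 1) := inferInstance
  obtain ⟨b, hb⟩ := strong_collection S
    (P := fun τ s => k < s ∧ ¬ ∃ ρ, Level T s ρ ∧ Agree k ρ τ) (triple k m N + 1)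
  have key : ∀ s t σ, max b k < s → max b k < t → Level T s σ →
      ∃ ρ, Level T t ρ ∧ Agree k ρ σ := by
    intro s t σ hs ht hσ
    by_contra hn
    obtain ⟨τ, hτ, hag⟩ := hT.out.exists_truncate S hσ ((le_max_right b k).trans hs.le)
    obtain ⟨s', hs', hks', hn'⟩ := hb τ (lt_succ.2 (hT.out.level_le S hm hτ))
      ⟨t, (le_max_right b k).trans_lt ht, fun ⟨ρ, hρ, hρ'⟩ => hn ⟨ρ, hρ, hρ'.trans hag⟩⟩
    obtain ⟨ρ, hρ, hρ'⟩ := hT.out.exists_truncate S hσ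
      ((hs'.le.trans (le_max_left b k)).trans hs.le)
    exact hn' ⟨ρ, hρ, (hρ'.mono hks'.le).trans hag.symm⟩
  refine ⟨max b k, fun s t σ τ hs ht hσ hτ => ?_⟩
  exact hσ.agree S hτ ((le_max_right b k).trans hs.le) ((le_max_right b k).trans ht.le)
    (key s t σ hs ht hσ.1) (key t s τ ht hs hτ.1)

/-! ### The tournament of a tree -/

/-- The relation with `R(x, s)` if the leftmost element of `T` of length `s` has value `1` at `x`,
and `R(s, x)` otherwise, for `x < s`. -/
def leftmostRel (T : Set M) : Set M :=
  {z | ∃ x, x ≤ z ∧ ∃ y, y ≤ z ∧ z = pair x y ∧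
    ((x < y ∧ LeftmostBit T x y) ∨ (y < x ∧ ¬ LeftmostBit T y x))}

lemma rel_leftmostRel {x y : M} : Rel (leftmostRel T) x y ↔
    (x < y ∧ LeftmostBit T x y) ∨ (y < x ∧ ¬ LeftmostBit T y x) := by
  constructor
  · rintro ⟨x', -, y', -, h, h'⟩
    obtain ⟨rfl, rfl⟩ := pair_inj h
    exact h'
  · exact fun h => ⟨x, left_le_pair x y, y, right_le_pair x y, rfl, h⟩

lemma leftmostRel_mem [Fact (IsBinaryTree T)] [Fact (T ∈ S)] : leftmostRel T ∈ S := by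
  have : Delta1 S fun v => ∃ x, x ≤ v 0 ∧ ∃ y, y ≤ v 0 ∧ v 0 = pair x y ∧
    ((x < y ∧ LeftmostBit T x y) ∨ (y < x ∧ ¬ LeftmostBit T y x)) := inferInstance
  exact comprehension S (P := fun z => ∃ x, x ≤ z ∧ ∃ y, y ≤ z ∧ z = pair x y ∧
    ((x < y ∧ LeftmostBit T x y) ∨ (y < x ∧ ¬ LeftmostBit T y x)))

lemma isTournament_leftmostRel : IsTournament Set.univ (leftmostRel T) where
  on := by
    rintro z ⟨x, -, y, -, h, -⟩
    exact ⟨x, trivial, y, trivial, h⟩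
  irrefl x _ h := by
    rw [rel_leftmostRel] at h
    simp at h
  exactly_one x _ y _ hxy := by
    rw [rel_leftmostRel, rel_leftmostRel]
    rcases hxy.lt_or_gt with h | h
    · simp [h, h.not_gt, xor_iff_not_iff]
    · simp [h, h.not_gt, xor_iff_not_iff]

lemma isStable_leftmostRel (S : Set (Set M)) [RCA S] [Fact (IsBinaryTree T)] [Fact (T ∈ S)]
    (hi : Infinite T) : IsStable Set.univ (leftmostRel T) := by
  intro x _
  -- Agreement below `x + 1` includes the position `x`.
  obtain ⟨n, hn⟩ := leftmost_stable S (T := T) (x + 1)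
  obtain ⟨σ, hσ⟩ := exists_leftmost S hi (max n x + 1)
  have hns : n < max n x + 1 := lt_succ.2 (le_max_left n x)
  have key : ∀ y, max n x < y → (LeftmostBit T x y ↔ HasValue σ x 1) := fun y hy => by
    obtain ⟨τ, hτ⟩ := exists_leftmost S hi y
    rw [hτ.leftmostBit_iff S ((le_max_right n x).trans_lt hy)]
    exact (hn _ _ σ τ hns ((le_max_left n x).trans_lt hy) hσ hτ x (lt_succ.2 le_rfl)).symm
  refine ⟨max n x, ?_⟩
  by_cases h : HasValue σ x 1
  · exact Or.inl fun y hy _ => rel_leftmostRel.2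
      (Or.inl ⟨(le_max_right n x).trans_lt hy, (key y hy).2 h⟩)
  · exact Or.inr fun y hy _ => rel_leftmostRel.2
      (Or.inr ⟨(le_max_right n x).trans_lt hy, fun h' => h ((key y hy).1 h')⟩)

end

section

variable {M : Type u} [CommSemiring M] [LinearOrder M] [DiscreteSemiring M]

lemma HasLength.exists_value {σ l i : M} (h : HasLength σ l) (hi : i < l) :
    HasValue σ i 0 ∨ HasValue σ i 1 := by
  rw [h.hasValue_zero hi]
  tauto

lemma not_hasValue_zero_and_one {σ i : M} : ¬ (HasValue σ i 0 ∧ HasValue σ i 1) := by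
  rintro ⟨⟨l, m, n, rfl, hi, h⟩, h'⟩
  rw [hasValue_triple] at h'
  simp at h h'
  exact h h'.2

/-! ### The tree of cuts -/

/-- The strings in `T` whose set of ones in `E` is closed downwards under `R`. -/
def cutTree (T E R : Set M) : Set M :=
  {σ | σ ∈ T ∧ ∀ x, x < σ → x ∈ E → ∀ y, y < σ → y ∈ E → Rel R x y → HasValue σ y 1 →
    ¬ HasValue σ x 0}

lemma HasValue.lt {σ i c : M} (h : HasValue σ i c) : i < σ := by
  obtain ⟨l, m, n, rfl, hi, -⟩ := h
  exact hi.trans_le (fst_le_triple l m n)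

/-- Positions in a string are smaller than its code, so the bounds in `cutTree`, which keep it
`Δ⁰₁`, can be dropped. -/
lemma mem_cutTree {T E R : Set M} {σ : M} : σ ∈ cutTree T E R ↔ σ ∈ T ∧
    ∀ x ∈ E, ∀ y ∈ E, Rel R x y → HasValue σ y 1 → ¬ HasValue σ x 0 :=
  and_congr_right fun _ => ⟨fun h x hx y hy hR h1 h0 => h x h0.lt hx y h1.lt hy hR h1 h0,
    fun h x _ hx y _ hy => h x hx y hy⟩

lemma IsBinaryTree.cutTree {T : Set M} (hT : IsBinaryTree T) (E R : Set M) :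
    IsBinaryTree (cutTree T E R) where
  strings σ hσ := hT.strings σ hσ.1
  closed σ hσ τ hτ h := mem_cutTree.2 ⟨hT.closed σ hσ.1 τ hτ h,
    fun x hx y hy hR h1 h0 => (mem_cutTree.1 hσ).2 x hx y hy hR (h _ _ h1) (h _ _ h0)⟩

variable {S : Set (Set M)} [hS : RCA S] {T : Set M}

instance Delta1.rel {R : Set M} [Fact (R ∈ S)] {s t : (ℕ → M) → M} [TermFn s] [TermFn t] :
    Delta1 S (fun v => Rel R (s v) (t v)) :=
  inferInstanceAs (Delta1 S fun v => SecondOrderArith.pair (s v) (t v) ∈ R)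

lemma cutTree_mem {E R : Set M} [Fact (T ∈ S)] [Fact (E ∈ S)] [Fact (R ∈ S)] :
    cutTree T E R ∈ S :=
  comprehension S (P := fun σ => σ ∈ T ∧ ∀ x, x < σ → x ∈ E → ∀ y, y < σ → y ∈ E → Rel R x y →
    HasValue σ y 1 → ¬ HasValue σ x 0)

/-- The leftmost strings whose length is in a transitive sub-tournament of the tournament of the
tree are cuts. -/
lemma infinite_cutTree (S : Set (Set M)) [RCA S] [Fact (IsBinaryTree T)] [Fact (T ∈ S)]
    (hi : Infinite T) {E : Set M} (hE : Infinite E)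
    (htrans : ∀ x ∈ E, ∀ y ∈ E, ∀ z ∈ E, Rel (leftmostRel T) x y → Rel (leftmostRel T) y z →
      Rel (leftmostRel T) x z) : Infinite (cutTree T E (leftmostRel T)) := by
  intro k
  obtain ⟨s, hsE, hks⟩ := hE k
  obtain ⟨σ, hσ⟩ := exists_leftmost S hi s
  refine ⟨σ, mem_cutTree.2 ⟨hσ.1.1, fun x hx y hy hR h1 h0 => ?_⟩, hks.trans_le hσ.1.2.le⟩
  have hlt : ∀ i c, HasValue σ i c → i < s := by
    rintro i c ⟨l, m, n, h, hi, -⟩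
    rwa [hσ.1.2.unique ⟨m, n, h⟩]
  have hxs := hlt _ _ h0
  have hys := hlt _ _ h1
  -- The length `s` is itself a vertex of `E`: the value `1` at `y` says `R(y, s)`, and transitivity
  -- yields `R(x, s)`, that is, value `1` at `x`.
  have h2 := htrans x hx y hy s hsE hR
    (rel_leftmostRel.2 (Or.inl ⟨hys, (hσ.leftmostBit_iff S hys).2 h1⟩))
  rw [rel_leftmostRel] at h2
  rcases h2 with ⟨-, h2⟩ | ⟨h2, -⟩
  · exact not_hasValue_zero_and_one ⟨h0, (hσ.leftmostBit_iff S hxs).1 h2⟩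
  · exact hxs.not_gt h2

/-! ### Homogeneous sets -/

/-- The length of a string is at most its code, so homogeneous strings of unbounded length suffice.
-/
lemma homogeneousForTree {H : Set M} {c : M} (hc : c = 0 ∨ c = 1)
    (h : ∀ k, ∃ l σ, k < l ∧ Level T l σ ∧ ∀ i ∈ H, i < l → HasValue σ i c) :
    HomogeneousForTree H T := by
  intro k
  obtain ⟨l, σ, hkl, hσ, hH⟩ := h k
  refine ⟨σ, ⟨hσ.1, c, hc, fun i hi l' hl' hil' => hH i hi ?_⟩, hkl.trans_le hσ.2.le⟩
  rwa [hσ.2.unique hl']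

/-- All strings of some length in the tree `C` have value `c` at `x`. -/
def Forces (C : Set M) (c x : M) : Prop :=
  ∃ k, x < k ∧ ∀ σ, Level C k σ → HasValue σ x c

instance Sigma1.forces {C : Set M} [Fact (IsBinaryTree C)] [Fact (C ∈ S)] {c : M} :
    Sigma1 S (fun v => Forces C c (v 0)) :=
  inferInstanceAs (Sigma1 S fun v => ∃ k, v 0 < k ∧ ∀ σ, Level C k σ → HasValue σ (v 0) c)

lemma HasValue.of_agree {τ σ l k i c : M} (h : HasValue τ i c) (hσ : HasLength σ l)
    (hτ : HasLength τ k) (hkl : k ≤ l) (hag : Agree k τ σ) : HasValue σ i c :=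
  hσ.isPrefix hτ hkl hag i c h

lemma Forces.hasValue (S : Set (Set M)) [RCA S] {C : Set M} (hC : IsBinaryTree C) {c x : M}
    (h : Forces C c x) : ∃ k, x < k ∧ ∀ l σ, k ≤ l → Level C l σ → HasValue σ x c := by
  obtain ⟨k, hxk, hk⟩ := h
  refine ⟨k, hxk, fun l σ hkl hσ => ?_⟩
  obtain ⟨τ, hτ, hag⟩ := hC.exists_truncate S hσ hkl
  exact (hk τ hτ).of_agree hσ.2 hτ.2 hkl hag

/-- An infinite set of numbers at which the value `c` is forced is homogeneous. -/
lemma homogeneous_of_forces (S : Set (Set M)) [RCA S] {C H : Set M} [hC : Fact (IsBinaryTree C)]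
    [Fact (C ∈ S)] [Fact (H ∈ S)] (hi : Infinite C) (hCT : C ⊆ T) {c : M} (hc : c = 0 ∨ c = 1)
    (hH : ∀ x ∈ H, Forces C c x) : HomogeneousForTree H T := by
  refine homogeneousForTree hc fun k => ?_
  -- By level `b` the value `c` is forced at all elements of `H` up to `k`; outside `H` the witness
  -- is a dummy.
  obtain ⟨b, hb⟩ := collection S
    (P := fun x j => x ∈ H → x < j ∧ ∀ σ, Level C j σ → HasValue σ x c) (k + 1) fun x _ => by
      by_cases hx : x ∈ H
      · obtain ⟨j, hj⟩ := hH x hx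
        exact ⟨j, fun _ => hj⟩
      · exact ⟨0, fun h => absurd h hx⟩
  obtain ⟨σ, hσ⟩ := hC.out.exists_level S hi (max b (k + 1))
  -- Truncation is needed because `σ` may reach elements of `H` above `k` whose value is not yet
  -- forced.
  obtain ⟨τ, hτ, hag⟩ := hC.out.exists_truncate S hσ (le_max_right b (k + 1))
  refine ⟨k + 1, τ, lt_succ.2 le_rfl, ⟨hCT hτ.1, hτ.2⟩, fun i hiH hik => ?_⟩
  have h1 : HasValue σ i c := by
    obtain ⟨j, hjb, hj⟩ := hb i hik
    obtain ⟨hij, hj⟩ := hj hiH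
    obtain ⟨ρ, hρ, hag'⟩ := hC.out.exists_truncate S hσ (hjb.le.trans (le_max_left b (k + 1)))
    exact (hj ρ hρ).of_agree hσ.2 hρ.2 (hjb.le.trans (le_max_left _ _)) hag'
  rcases hτ.2.exists_value hik with h | h <;> rcases hc with rfl | rfl
  · exact h
  · exact (not_hasValue_zero_and_one ⟨h.of_agree hσ.2 hτ.2 (le_max_right _ _) hag, h1⟩).elim
  · exact (not_hasValue_zero_and_one ⟨h1, h.of_agree hσ.2 hτ.2 (le_max_right _ _) hag⟩).elim
  · exact h

lemma not_infinite {X : Set M} (h : ¬ Infinite X) : ∃ k, ∀ n ∈ X, n ≤ k := by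
  unfold Infinite at h
  push Not at h
  exact h

/-- If a tree of cuts of an infinite tournament has no homogeneous set of the form
`{y | R(y, x)}` or `{y | R(x, y)}`, then a value is forced at every `x`. -/
lemma exists_homogeneous_of_cutTree (S : Set (Set M)) [RCA S] [hT : Fact (IsBinaryTree T)]
    [hTS : Fact (T ∈ S)] {E R : Set M} [hES : Fact (E ∈ S)] [hRS : Fact (R ∈ S)] (hE : Infinite E)
    (hR : ∀ x ∈ E, ∀ y ∈ E, x ≠ y → Rel R x y ∨ Rel R y x) (hC : Infinite (cutTree T E R)) :
    ∃ H ∈ S, Infinite H ∧ HomogeneousForTree H T := by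
  have hCtree : Fact (IsBinaryTree (cutTree T E R)) := ⟨hT.out.cutTree E R⟩
  have hCS : Fact (cutTree T E R ∈ S) := ⟨cutTree_mem⟩
  have hCT : cutTree T E R ⊆ T := fun σ hσ => hσ.1
  by_contra hno
  have hno' : ∀ H ∈ S, HomogeneousForTree H T → ∃ k, ∀ n ∈ H, n ≤ k := fun H hH hH' =>
    not_infinite fun h => hno ⟨H, hH, h, hH'⟩
  have hforces : ∀ x ∈ E, Forces (cutTree T E R) 0 x ∨ Forces (cutTree T E R) 1 x := by
    intro x hx
    by_contra! hn
    -- No level forces `1` at `x`, so each level above `x` has a cut with `0` there; `h1` is the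
    -- dual.
    have h0 : ∀ k, x < k → ∃ σ, Level (cutTree T E R) k σ ∧ HasValue σ x 0 := fun k hk => by
      have h := hn.2
      unfold Forces at h
      push Not at h
      obtain ⟨σ, hσ, h'⟩ := h k hk
      exact ⟨σ, hσ, (hσ.2.exists_value hk).resolve_right h'⟩
    have h1 : ∀ k, x < k → ∃ σ, Level (cutTree T E R) k σ ∧ HasValue σ x 1 := fun k hk => by
      have h := hn.1
      unfold Forces at h
      push Not at h
      obtain ⟨σ, hσ, h'⟩ := h k hk
      exact ⟨σ, hσ, (hσ.2.exists_value hk).resolve_left h'⟩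
    -- Cuts with `1` at `x` have `1` at all predecessors of `x`, so these are bounded by assumption;
    -- the successors are bounded in the same way.
    obtain ⟨a, ha⟩ := hno' _ (comprehension S (P := fun y => y ∈ E ∧ Rel R y x))
      (homogeneousForTree (Or.inr rfl) fun k => by
        obtain ⟨σ, hσ, hx1⟩ := h1 (max k x + 1) (lt_succ.2 (le_max_right k x))
        refine ⟨_, σ, lt_succ.2 (le_max_left k x), ⟨hCT hσ.1, hσ.2⟩, fun i hi hil => ?_⟩
        exact (hσ.2.exists_value hil).resolve_left
          ((mem_cutTree.1 hσ.1).2 i hi.1 x hx hi.2 hx1))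
    obtain ⟨b, hb⟩ := hno' _ (comprehension S (P := fun y => y ∈ E ∧ Rel R x y))
      (homogeneousForTree (Or.inl rfl) fun k => by
        obtain ⟨σ, hσ, hx0⟩ := h0 (max k x + 1) (lt_succ.2 (le_max_right k x))
        refine ⟨_, σ, lt_succ.2 (le_max_left k x), ⟨hCT hσ.1, hσ.2⟩, fun i hi hil => ?_⟩
        exact (hσ.2.exists_value hil).resolve_right
          fun h1 => (mem_cutTree.1 hσ.1).2 x hx i hi.1 hi.2 h1 hx0)
    obtain ⟨y, hy, hlt⟩ := hE (max x (max a b))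
    obtain ⟨hxy, hay, hby⟩ : x < y ∧ a < y ∧ b < y := by simpa using hlt
    rcases hR x hx y hy hxy.ne with h | h
    · exact (hb y ⟨hy, h⟩).not_gt hby
    · exact (ha y ⟨hy, h⟩).not_gt hay
  have hboth : ∀ x, ¬ (Forces (cutTree T E R) 0 x ∧ Forces (cutTree T E R) 1 x) := by
    rintro x ⟨h0, h1⟩
    obtain ⟨k, -, hk⟩ := h0.hasValue S hCtree.out
    obtain ⟨j, -, hj⟩ := h1.hasValue S hCtree.out
    obtain ⟨σ, hσ⟩ := hCtree.out.exists_level S hC (max k j)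
    exact not_hasValue_zero_and_one ⟨hk _ σ (le_max_left k j) hσ, hj _ σ (le_max_right k j) hσ⟩
  have hmem : ∀ c d : M, (∀ x ∈ E, (¬ Forces (cutTree T E R) c x ↔ Forces (cutTree T E R) d x)) →
      {x | x ∈ E ∧ Forces (cutTree T E R) c x} ∈ S := fun c d hcd => by
    -- Forcing is only `Σ⁰₁`. Inside `E`, not forcing `c` means forcing `d`, which makes the
    -- complement `Σ⁰₁` too.
    have : Delta1 S fun v => v 0 ∈ E ∧ Forces (cutTree T E R) c (v 0) := by
      refine ⟨inferInstance, ?_⟩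
      have h1 : Sigma1 S fun v => ¬ v 0 ∈ E ∨ Forces (cutTree T E R) d (v 0) := inferInstance
      refine h1.congr fun v => ?_
      have := hcd (v 0)
      tauto
    exact comprehension S (P := fun x => x ∈ E ∧ Forces (cutTree T E R) c x)
  have key : ∀ c : M, c = 0 ∨ c = 1 → ∀ d : M,
      (∀ x ∈ E, (¬ Forces (cutTree T E R) c x ↔ Forces (cutTree T E R) d x)) →
      ∃ k, ∀ x ∈ {x | x ∈ E ∧ Forces (cutTree T E R) c x}, x ≤ k := fun c hc d hcd => by
    have hf : Fact ({x | x ∈ E ∧ Forces (cutTree T E R) c x} ∈ S) := ⟨hmem c d hcd⟩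
    exact hno' _ hf.out (homogeneous_of_forces S hC hCT hc fun x hx => hx.2)
  obtain ⟨a, ha⟩ := key 0 (Or.inl rfl) 1 fun x hx => by
    have := hforces x hx
    have := hboth x
    tauto
  obtain ⟨b, hb⟩ := key 1 (Or.inr rfl) 0 fun x hx => by
    have := hforces x hx
    have := hboth x
    tauto
  obtain ⟨y, hy, hlt⟩ := hE (max a b)
  obtain ⟨hay, hby⟩ : a < y ∧ b < y := by simpa using hlt
  rcases hforces y hy with h | h
  · exact (ha y ⟨hy, h⟩).not_gt hay
  · exact (hb y ⟨hy, h⟩).not_gt hby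

/-! ### The implication from `SEM` to `RWKL` -/

lemma rwkl_of_sem (S : Set (Set M)) [RCA S] (hSEM : SEM S) : RWKL S := by
  intro T hTS hT hi
  have hT' : Fact (IsBinaryTree T) := ⟨hT⟩
  have hTS' : Fact (T ∈ S) := ⟨hTS⟩
  have huniv : (Set.univ : Set M) ∈ S := by
    have := comprehension S (P := fun _ : M => True)
    rwa [Set.ofPred_true] at this
  have hR : leftmostRel T ∈ S := leftmostRel_mem
  obtain ⟨E, hE, U, -, ⟨-, hU⟩, hEinf, htrans⟩ := hSEM _ huniv _ hR isTournament_leftmostRel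
    (fun k => ⟨k + 1, trivial, lt_succ.2 le_rfl⟩) (isStable_leftmostRel S hi)
  have hE' : Fact (E ∈ S) := ⟨hE⟩
  have hR' : Fact (leftmostRel T ∈ S) := ⟨hR⟩
  refine exists_homogeneous_of_cutTree S (R := leftmostRel T) hEinf (fun x _ y _ hxy => ?_)
    (infinite_cutTree S hi hEinf fun x hx y hy z hz hxy hyz => ?_)
  · exact (isTournament_leftmostRel.exactly_one x trivial y trivial hxy).or
  · exact ((hU _).1 (htrans x y z ((hU _).2 ⟨hxy, x, hx, y, hy, rfl⟩)
      ((hU _).2 ⟨hyz, y, hy, z, hz, rfl⟩))).1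

end

end SecondOrderArith

theorem mainTheorem10 {M : Type*} [Zero M] [One M] [Add M] [Mul M] [LT M] (S : Set (Set M))
    (hRCA : SecondOrderArith.ModelsRCA0 S) (hSEM : SecondOrderArith.SEM S) :
    SecondOrderArith.RWKL S := by
  -- With `let` the structures stay transparent, so their operations and `<` are definitionally the
  -- given ones.
  let i1 : CommSemiring M := hRCA.toCommSemiring
  let i2 : LinearOrder M := hRCA.toLinearOrder
  have h1 : IsStrictOrderedRing M := hRCA.toIsStrictOrderedRing
  have h2 : CanonicallyOrderedAdd M := hRCA.toCanonicallyOrderedAdd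
  have h3 : SecondOrderArith.DiscreteSemiring M :=
    { lt_add_one_iff' := fun a b => (hRCA.basic.lt_succ a b).trans le_iff_lt_or_eq.symm }
  have h4 : SecondOrderArith.RCA S := ⟨hRCA⟩
  exact SecondOrderArith.rwkl_of_sem S hSEM
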